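/- Conventions. $2^{<\mathbb N}$ is the set of finite binary strings and $2^{\mathbb N}$ is Cantor space with the uniform measure $\lambda$. A $\Pi^0_1$ class is the complement of $\bigcup_{\sigma\in S}\{X\in 2^{\mathbb N}:\sigma\prec X\}$ for a c.e. set $S\subseteq 2^{<\mathbb N}$; the empty class is allowed. A Turing functional is a c.e. set $\Phi$ of pairs of strings such that $\tau,\tau'$ are comparable under the prefix relation whenever $(\sigma,\tau),(\sigma',\tau')\in\Phi$ and $\sigma\preceq\sigma'$; $\Phi^X$ is the (finite or infinite) sequence determined by the strings $\tau$ with $(\sigma,\tau)\in\Phi$ for some $\sigma\prec X$; $X\in\mathrm{dom}(\Phi)$ if $\Phi^X$ is infinite, and then $\Phi(X)=\Phi^X$. Let $(\Phi_e)_{e\in\mathbb N}$ be an effective enumeration of all Turing functionals, let $\widehat\Phi$ be the universal functional given by $\widehat\Phi(1^e0X)=\Phi_e(X)$, and let $$\mathbf M(\sigma)=\lambda\{X:\widehat\Phi^X\succeq\sigma\},$$ which is a universal lower semi-computable continuous semi-measure. For a $\Pi^0_1$ class $\mathcal C$ let $T$ be its canonical co-c.e. tree, i.e. the set of all finite prefixes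 of members of $\mathcal C$, and let $T_n$ be the set of strings of length $n$ in $T$. The class $\mathcal C$ is *deep* if there is a computable, non-decreasing, unbounded $h:\mathbb N\to\mathbb N$ such that $$\mathbf M(T_n):=\sum_{\sigma\in T_n}\mathbf M(\sigma)\le 2^{-h(n)}\quad\text{for all } n.$$ For $\Pi^0_1$ classes $\mathcal C,\mathcal D$, write $\mathcal C\le_s\mathcal D$ (Medvedev reducibility) if there is one Turing functional $\Phi$ with $\mathcal D\subseteq\mathrm{dom}(\Phi)$ and $\Phi(\mathcal D)\subseteq\mathcal C$. Let $\mathcal E_s$ be the set of equivalence classes of $\Pi^0_1$ classes under ($\mathcal C\le_s\mathcal D$ and $\mathcal D\le_s\mathcal C$), ordered by $\le_s$; it is a lattice, with greatest lower bounds induced by $\inf(\mathcal C,\mathcal D)=\{0^\frown X:X\in\mathcal C\}\cup\{1^\frown Y:Y\in\mathcal D\}$ and least upper bounds induced by $\sup(\mathcal C,\mathcal D)=\{X\oplus Y:X\in\mathcal C,\ Y\in\mathcal D\}$. A *filter* in a lattice is a subset $F$ such that $x\in F$ and $x\le y$ imply $y\in F$, and $x,y\in F$ implies $\inf(x,y)\in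 F$. **Theorem.** The collection of deep $\Pi^0_1$ classes forms a filter in $\mathcal E_s$. That is, for all $\Pi^0_1$ classes $\mathcal C,\mathcal D$: (i) if $\mathcal C$ is deep and $\mathcal C\le_s\mathcal D$, then $\mathcal D$ is deep (in particular, depth is invariant under Medvedev equivalence); (ii) if $\mathcal C$ and $\mathcal D$ are deep, then $\inf(\mathcal C,\mathcal D)$ is deep; and the set of Medvedev degrees of deep $\Pi^0_1$ classes is a filter in the lattice $\mathcal E_s$. -/

import Mathlib

/-!  Deep effectively closed classes and the lattice of Medvedev degrees. -/

open scoped ENNReal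

namespace DeepClasses

/-! ### Strings, sequences, computably enumerable sets -/

/-- Finite binary strings; `σ <+: τ` says that `σ` is a prefix of `τ`. -/
abbrev Str : Type := List Bool

/-- Cantor space: infinite binary sequences. -/
abbrev Cantor : Type := ℕ → Bool

/-- The string formed by the first `n` bits of `X`. -/
def restr (X : Cantor) (n : ℕ) : Str := (List.range n).map X

/-- The finite string `σ` is a prefix of the infinite sequence `X`. -/
def PrefixOf (σ : Str) (X : Cantor) : Prop := restr X σ.length = σ

/-- Two strings are comparable if one of them is a prefix of the other. -/
def Comparable (σ τ : Str) : Prop := σ <+: τ ∨ τ <+: σ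

instance (σ τ : Str) : Decidable (Comparable σ τ) := by
  unfold Comparable; infer_instance

/-- The open set of all sequences with a prefix in `S`. -/
def openOf (S : Set Str) : Set Cantor := {X | ∃ σ ∈ S, PrefixOf σ X}

/-- `C` is a `Π⁰₁` class: the complement of the open set generated by a c.e. set of strings. -/
def IsPi01 (C : Set Cantor) : Prop :=
  ∃ S : Set Str, REPred (fun σ => σ ∈ S) ∧ C = (openOf S)ᶜ

/-- The canonical co-c.e. tree of `C`: all prefixes of members of `C`. -/
def canonicalTree (C : Set Cantor) : Set Str := {σ | ∃ X ∈ C, PrefixOf σ X}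

/-- The `n`-th level of a tree. -/
def level (T : Set Str) (n : ℕ) : Set Str := {σ ∈ T | σ.length = n}

/-! ### Turing functionals -/

/-- Consistency of a set of pairs of strings. -/
def Consistent (Φ : Set (Str × Str)) : Prop :=
  ∀ σ τ σ' τ' : Str, (σ, τ) ∈ Φ → (σ', τ') ∈ Φ → σ <+: σ' → Comparable τ τ'

/-- A Turing functional is a consistent c.e. set of pairs of strings. -/
def IsTuringFunctional (Φ : Set (Str × Str)) : Prop :=
  REPred (fun p => p ∈ Φ) ∧ Consistent Φ

/-- `τ` is a prefix of the (finite or infinite) output `Φ^X`. The empty string always is. -/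
def Outputs (Φ : Set (Str × Str)) (X : Cantor) (τ : Str) : Prop :=
  τ = [] ∨ ∃ σ τ' : Str, (σ, τ') ∈ Φ ∧ PrefixOf σ X ∧ τ <+: τ'

/-- `X ∈ dom Φ` and `Φ(X) = Y`: every initial segment of `Y` is a prefix of `Φ^X`. -/
def MapsTo (Φ : Set (Str × Str)) (X Y : Cantor) : Prop := ∀ n : ℕ, Outputs Φ X (restr Y n)

/-! ### A universal Turing functional and a priori probability -/

/-- The pair of strings (if any) which the `e`-th partial computable function puts at stage `s`
into the c.e. set of pairs given by its domain. Every element of this c.e. set appears at some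
stage. -/
def candidate (e s : ℕ) : Option (Str × Str) :=
  (Nat.Partrec.Code.evaln s.unpair.2 (Denumerable.ofNat Nat.Partrec.Code e) s.unpair.1).bind
    fun _ => Encodable.decode s.unpair.1

/-- The finite list of pairs accepted before stage `s`: a new pair is accepted only
if it keeps the list consistent. -/
def accepted (e : ℕ) : ℕ → List (Str × Str)
  | 0 => []
  | s + 1 =>
    match candidate e s with
    | none => accepted e s
    | some p =>
      if ∀ q ∈ accepted e s, Comparable p.1 q.1 → Comparable p.2 q.2 then p :: accepted e s
      else accepted e s

/-- The `e`-th Turing functional `Φ_e`. This is an effective list of all Turing functionals: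
a consistent c.e. set of pairs is not changed by the acceptance procedure. -/
def functional (e : ℕ) : Set (Str × Str) := {p | ∃ s, p ∈ accepted e s}

/-- The universal Turing functional, `Φ(1^e 0 X) = Φ_e(X)`. -/
def universalFunctional : Set (Str × Str) :=
  {p | ∃ (e : ℕ) (σ : Str), (σ, p.2) ∈ functional e ∧
    p.1 = List.replicate e true ++ false :: σ}

/-- The uniform measure on Cantor space (independent tosses of a fair coin). -/
noncomputable def fairCoin : MeasureTheory.Measure Cantor :=
  MeasureTheory.Measure.infinitePi fun _ : ℕ => (PMF.uniformOfFintype Bool).toMeasure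

/-- The semi-measure induced by a Turing functional: the probability that `Φ^X` extends `σ`. -/
noncomputable def inducedSemimeasure (Φ : Set (Str × Str)) (σ : Str) : ℝ≥0∞ :=
  fairCoin {X | Outputs Φ X σ}

/-- A priori probability `M`: the universal lower semi-computable continuous semi-measure induced
by the universal Turing functional. -/
noncomputable def aprioriM (σ : Str) : ℝ≥0∞ := inducedSemimeasure universalFunctional σ

/-! ### Depth -/

/-- A computable order: a computable, non-decreasing and unbounded function. -/
def IsComputableOrder (h : ℕ → ℕ) : Prop :=
  Computable h ∧ Monotone h ∧ ∀ k, ∃ n, k ≤ h n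

/-- `C` is deep: for some computable order `h`, the a priori probability of the `n`-th level of the
canonical co-c.e. tree of `C` is at most `2 ^ (-h n)`, for all `n`. (The inequality is not strict,
because at `n = 0` the left side is `1` unless `C` is empty.) -/
def IsDeep (C : Set Cantor) : Prop :=
  ∃ h : ℕ → ℕ, IsComputableOrder h ∧
    ∀ n : ℕ, ∑' σ : level (canonicalTree C) n, aprioriM σ ≤ (2⁻¹ : ℝ≥0∞) ^ h n

/-! ### Operations on sequences and classes -/

/-- The sequence `b ⌢ X`. -/
def consSeq (b : Bool) (X : Cantor) : Cantor
  | 0 => b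
  | n + 1 => X n

/-- The sequence `X ⊕ Y`. -/
def joinSeq (X Y : Cantor) : Cantor := fun n => if n % 2 = 0 then X (n / 2) else Y (n / 2)

/-- `inf(C, D) = {0 ⌢ X | X ∈ C} ∪ {1 ⌢ Y | Y ∈ D}`. -/
def infClass (C D : Set Cantor) : Set Cantor := consSeq false '' C ∪ consSeq true '' D

/-- `sup(C, D) = {X ⊕ Y | X ∈ C, Y ∈ D}`. -/
def supClass (C D : Set Cantor) : Set Cantor := Set.image2 joinSeq C D

/-- `C ≤ₛ D`: one Turing functional is defined on all of `D` and maps `D` into `C`. -/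
def MedvedevLE (C D : Set Cantor) : Prop :=
  ∃ Φ : Set (Str × Str), IsTuringFunctional Φ ∧ ∀ X ∈ D, ∃ Y ∈ C, MapsTo Φ X Y

/-! ### Closure properties of c.e. predicates -/

section RE

variable {α β : Type} [Primcodable α] [Primcodable β]

theorem re_comp {p : β → Prop} (hp : REPred p) {f : α → β} (hf : Computable f) :
    REPred fun a => p (f a) :=
  Partrec.comp hp hf

theorem re_normal {p : α → Prop} (hp : REPred p) :
    ∃ f : α → ℕ → Bool, Computable₂ f ∧ ∀ a, p a ↔ ∃ n, f a n = true := by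
  obtain ⟨c, hc⟩ := Nat.Partrec.Code.exists_code.1 hp
  refine ⟨fun a n => (Nat.Partrec.Code.evaln n c (Encodable.encode a)).isSome, ?_, ?_⟩
  · change Computable fun x : α × ℕ =>
      (Nat.Partrec.Code.evaln x.2 c (Encodable.encode x.1)).isSome
    refine (Primrec.option_isSome.to_comp).comp ?_
    exact Nat.Partrec.Code.primrec_evaln.to_comp.comp
      ((Computable.snd.pair (Computable.const c)).pair (Computable.encode.comp Computable.fst))
  · intro a
    have h1 : p a ↔ (c.eval (Encodable.encode a)).Dom := by
      rw [hc]; simp [Part.assert]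
    rw [h1, Part.dom_iff_mem]
    simp only [Nat.Partrec.Code.evaln_complete, Option.isSome_iff_exists, Option.mem_def]
    exact exists_comm

theorem re_of_normal {f : α → ℕ → Bool} (hf : Computable₂ f) :
    REPred fun a => ∃ n, f a n = true := by
  have h : Partrec fun a => Nat.rfind fun n => (Part.some (f a n) : Part Bool) :=
    Partrec.rfind (Computable₂.partrec₂ hf)
  refine (h.dom_re).of_eq fun a => ?_
  rw [Part.dom_iff_mem]
  constructor
  · rintro ⟨n, hn⟩
    exact ⟨n, by simpa using (Nat.mem_rfind.1 hn).1⟩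
  · rintro ⟨n, hn⟩
    have : (Nat.rfind fun n => (Part.some (f a n) : Part Bool)).Dom :=
      Nat.rfind_dom.2 ⟨n, by simp [hn], fun _ => trivial⟩
    exact Part.dom_iff_mem.1 this

theorem re_and {p q : α → Prop} (hp : REPred p) (hq : REPred q) :
    REPred fun a => p a ∧ q a := by
  have h : Partrec fun a => (Part.assert (p a) fun _ => Part.some ()).bind
      fun _ => Part.assert (q a) fun _ => Part.some () :=
    Partrec.bind hp (Partrec.comp hq Computable.fst)
  refine (h.dom_re).of_eq fun a => ?_
  simp [Part.assert]

theorem re_or {p q : α → Prop} (hp : REPred p) (hq : REPred q) :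
    REPred fun a => p a ∨ q a := by
  obtain ⟨f, hf, hfp⟩ := re_normal hp
  obtain ⟨g, hg, hgq⟩ := re_normal hq
  refine (re_of_normal (f := fun a n => f a n || g a n)
    (Computable.to₂ (Primrec.or.to_comp.comp hf hg))).of_eq fun a => ?_
  simp only [hfp, hgq, Bool.or_eq_true, exists_or]

theorem re_exists {p : α → β → Prop} (hp : REPred fun x : α × β => p x.1 x.2) :
    REPred fun a => ∃ b, p a b := by
  obtain ⟨f, hf, hfp⟩ := re_normal hp
  have hg : Computable₂ fun (a : α) (n : ℕ) =>
      ((Encodable.decode n.unpair.1 : Option β).map fun b => f (a, b) n.unpair.2).getD false := by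
    change Computable fun x : α × ℕ =>
      ((Encodable.decode x.2.unpair.1 : Option β).map
        fun b => f (x.1, b) x.2.unpair.2).getD false
    refine Computable.option_getD ?_ (Computable.const false)
    refine Computable.option_map ?_ ?_
    · exact Computable.decode.comp (Computable.fst.comp (Computable.unpair.comp Computable.snd))
    · change Computable fun y : (α × ℕ) × β => f (y.1.1, y.2) y.1.2.unpair.2
      refine hf.comp ((Computable.fst.comp Computable.fst).pair Computable.snd) ?_
      exact Computable.snd.comp (Computable.unpair.comp (Computable.snd.comp Computable.fst))
  refine (re_of_normal hg).of_eq fun a => ?_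
  constructor
  · rintro ⟨n, hn⟩
    rcases hd : (Encodable.decode n.unpair.1 : Option β) with _ | b
    · simp [hd] at hn
    · simp only [hd, Option.map_some, Option.getD_some] at hn
      exact ⟨b, (hfp (a, b)).2 ⟨_, hn⟩⟩
  · rintro ⟨b, hb⟩
    obtain ⟨n, hn⟩ := (hfp (a, b)).1 hb
    exact ⟨Nat.pair (Encodable.encode b) n, by simp [hn]⟩

theorem re_of_primrec {p : α → Prop} (hp : PrimrecPred p) : REPred p := by
  obtain ⟨_, h⟩ := hp
  exact ComputablePred.to_re ⟨_, h.to_comp⟩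

end RE

/-! ### Elementary facts about strings -/

theorem length_restr (X : Cantor) (n : ℕ) : (restr X n).length = n := by simp [restr]

theorem prefixOf_iff {σ : Str} {X : Cantor} :
    PrefixOf σ X ↔ ∀ i (h : i < σ.length), σ[i] = X i := by
  constructor
  · intro h i hi
    have h2 : σ[i]? = (restr X σ.length)[i]? := by rw [show restr X σ.length = σ from h]
    simpa [restr, hi] using h2
  · intro h
    refine List.ext_getElem (length_restr _ _) fun i h1 h2 => ?_
    simp [restr, h i h2]

theorem prefixOf_restr (X : Cantor) (n : ℕ) : PrefixOf (restr X n) X := by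
  simp [PrefixOf, length_restr]

theorem restr_prefix (X : Cantor) {n m : ℕ} (h : n ≤ m) : restr X n <+: restr X m := by
  unfold restr
  have h1 : List.range n <+: List.range m := by
    rw [List.prefix_iff_eq_take, List.length_range, List.take_range, min_eq_left h]
  exact h1.map X

theorem Comparable.symm {σ τ : Str} (h : Comparable σ τ) : Comparable τ σ := Or.symm h

theorem Comparable.of_prefix {σ τ σ' τ' : Str} (h : Comparable σ' τ') (h1 : σ <+: σ')
    (h2 : τ <+: τ') : Comparable σ τ := by
  rcases h with h | h
  · exact List.prefix_or_prefix_of_prefix (h1.trans h) h2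
  · exact List.prefix_or_prefix_of_prefix h1 (h2.trans h)

theorem Consistent.comparable {Φ : Set (Str × Str)} (h : Consistent Φ) {σ τ σ' τ' : Str}
    (h1 : (σ, τ) ∈ Φ) (h2 : (σ', τ') ∈ Φ) (hc : Comparable σ σ') : Comparable τ τ' := by
  rcases hc with hc | hc
  · exact h _ _ _ _ h1 h2 hc
  · exact (h _ _ _ _ h2 h1 hc).symm

theorem prefix_of_getElem {σ τ : Str} (hl : σ.length ≤ τ.length)
    (h : ∀ i (h1 : i < σ.length), σ[i] = τ[i]) : σ <+: τ := by
  rw [List.prefix_iff_eq_take]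
  refine List.ext_getElem (by simp [hl]) fun i h1 h2 => ?_
  simp [h i h1]

theorem comparable_iff {σ τ : Str} :
    Comparable σ τ ↔ ∀ i (h1 : i < σ.length) (h2 : i < τ.length), σ[i] = τ[i] := by
  constructor
  · rintro (h | h) i h1 h2
    · exact h.getElem h1
    · exact (h.getElem h2).symm
  · intro h
    rcases le_total σ.length τ.length with hl | hl
    · exact Or.inl (prefix_of_getElem hl fun i h1 => h i h1 (h1.trans_le hl))
    · exact Or.inr (prefix_of_getElem hl fun i h1 => (h i (h1.trans_le hl) h1).symm)

theorem primrec_prefix {α : Type} [Primcodable α] {f g : α → Str} (hf : Primrec f)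
    (hg : Primrec g) : PrimrecPred fun a => f a <+: g a := by
  have : PrimrecPred fun a => f a = (g a).take (f a).length :=
    Primrec.eq.comp hf (Primrec.list_take.comp (Primrec.list_length.comp hf) hg)
  exact this.of_eq fun a => List.prefix_iff_eq_take.symm

/-! ### The Turing functionals behind the lattice of Medvedev degrees -/

theorem identity_functional : IsTuringFunctional {p | p.2 = p.1} := by
  refine ⟨re_of_primrec (Primrec.eq.comp Primrec.snd Primrec.fst), ?_⟩
  intro σ τ σ' τ' h1 h2 h
  simp only [Set.mem_ofPred_eq] at h1 h2
  subst h1 h2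
  exact Or.inl h

theorem medvedevLE_refl (C : Set Cantor) : MedvedevLE C C :=
  ⟨_, identity_functional, fun X hX => ⟨X, hX, fun n =>
    Or.inr ⟨restr X n, restr X n, rfl, prefixOf_restr X n, List.prefix_refl _⟩⟩⟩

theorem medvedevLE_of_subset {C D : Set Cantor} (h : D ⊆ C) : MedvedevLE C D :=
  let ⟨Φ, hΦ, hm⟩ := medvedevLE_refl D
  ⟨Φ, hΦ, fun X hX => let ⟨Y, hY, hXY⟩ := hm X hX; ⟨Y, h hY, hXY⟩⟩

theorem medvedevLE_trans {C D E : Set Cantor} (h1 : MedvedevLE C D) (h2 : MedvedevLE D E) :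
    MedvedevLE C E := by
  obtain ⟨Ψ, ⟨hΨ, cΨ⟩, mΨ⟩ := h1
  obtain ⟨Φ, ⟨hΦ, cΦ⟩, mΦ⟩ := h2
  refine ⟨{p | ∃ τ' : Str, (τ', p.2) ∈ Ψ ∧ (τ' = [] ∨ ∃ τ : Str, (p.1, τ) ∈ Φ ∧ τ' <+: τ)},
    ⟨?_, ?_⟩, ?_⟩
  · refine re_exists (p := fun (p : Str × Str) (τ' : Str) =>
      (τ', p.2) ∈ Ψ ∧ (τ' = [] ∨ ∃ τ : Str, (p.1, τ) ∈ Φ ∧ τ' <+: τ)) ?_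
    refine re_and (re_comp hΨ (f := fun x : (Str × Str) × Str => (x.2, x.1.2)) ?_) (re_or ?_ ?_)
    · exact Computable.snd.pair (Computable.snd.comp Computable.fst)
    · exact re_of_primrec (Primrec.eq.comp Primrec.snd (Primrec.const []))
    · refine re_exists (p := fun (x : (Str × Str) × Str) (τ : Str) =>
        (x.1.1, τ) ∈ Φ ∧ x.2 <+: τ) ?_
      refine re_and (re_comp hΦ
        (f := fun y : ((Str × Str) × Str) × Str => (y.1.1.1, y.2)) ?_) (re_of_primrec ?_)
      · exact (Computable.fst.comp (Computable.fst.comp Computable.fst)).pair Computable.snd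
      · exact primrec_prefix (Primrec.snd.comp Primrec.fst) Primrec.snd
  · rintro σ υ σ' υ' ⟨τ₁, h1, h1'⟩ ⟨τ₂, h2, h2'⟩ hσ
    refine cΨ.comparable h1 h2 ?_
    rcases h1' with rfl | ⟨τ, hτ, hp⟩
    · exact Or.inl List.nil_prefix
    rcases h2' with rfl | ⟨τ', hτ', hp'⟩
    · exact Or.inr List.nil_prefix
    exact (cΦ _ _ _ _ hτ hτ' hσ).of_prefix hp hp'
  · intro X hX
    obtain ⟨Y, hY, hXY⟩ := mΦ X hX
    obtain ⟨Z, hZ, hYZ⟩ := mΨ Y hY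
    refine ⟨Z, hZ, fun n => ?_⟩
    rcases hYZ n with h | ⟨σ, τ, hm, hp, ht⟩
    · exact Or.inl h
    refine Or.inr ?_
    have hout := hXY σ.length
    rw [show restr Y σ.length = σ from hp] at hout
    rcases hout with rfl | ⟨σ', τ', hm', hp', ht'⟩
    · exact ⟨[], τ, ⟨[], hm, Or.inl rfl⟩, rfl, ht⟩
    · exact ⟨σ', τ, ⟨σ, hm, Or.inr ⟨τ', hm', ht'⟩⟩, hp', ht⟩

theorem restr_consSeq (b : Bool) (X : Cantor) (n : ℕ) :
    restr (consSeq b X) (n + 1) = b :: restr X n := by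
  simp [restr, List.range_succ_eq_map, consSeq, Function.comp_def]

theorem prefixOf_cons {b : Bool} {σ : Str} {X : Cantor} :
    PrefixOf (b :: σ) (consSeq b X) ↔ PrefixOf σ X := by
  simp [PrefixOf, restr_consSeq]

theorem consSeq_eta (X : Cantor) : consSeq (X 0) (fun n => X (n + 1)) = X := by
  funext n; cases n <;> rfl

theorem medvedevLE_cons (b : Bool) {C D : Set Cantor} (h : consSeq b '' D ⊆ C) :
    MedvedevLE C D := by
  refine ⟨{p | p.2 = b :: p.1}, ⟨re_of_primrec (Primrec.eq.comp Primrec.snd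
    (Primrec.list_cons.comp (Primrec.const b) Primrec.fst)), ?_⟩, ?_⟩
  · rintro σ τ σ' τ' h1 h2 hσ
    simp only [Set.mem_ofPred_eq] at h1 h2
    subst h1 h2
    exact Or.inl (List.cons_prefix_cons.2 ⟨rfl, hσ⟩)
  · refine fun X hX => ⟨consSeq b X, h ⟨X, hX, rfl⟩, fun n => ?_⟩
    cases n with
    | zero => exact Or.inl rfl
    | succ n =>
      refine Or.inr ⟨restr X n, b :: restr X n, rfl, prefixOf_restr X n, ?_⟩
      rw [restr_consSeq]

theorem primrec_head_tail {p q : Str × Str → Prop} (hp : REPred p) (hq : REPred q) :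
    REPred fun x : Str × Str => (x.1.head? = some false ∧ p (x.1.tail, x.2)) ∨
      (x.1.head? = some true ∧ q (x.1.tail, x.2)) := by
  have ht : Computable fun x : Str × Str => (x.1.tail, x.2) :=
    ((Primrec.list_tail.comp Primrec.fst).pair Primrec.snd).to_comp
  have hh (b : Bool) : REPred fun x : Str × Str => x.1.head? = some b :=
    re_of_primrec (Primrec.eq.comp (Primrec.list_head?.comp Primrec.fst) (Primrec.const (some b)))
  exact re_or (re_and (hh false) (re_comp hp ht)) (re_and (hh true) (re_comp hq ht))

theorem le_infClass {C D E : Set Cantor} (h1 : MedvedevLE E C) (h2 : MedvedevLE E D) :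
    MedvedevLE E (infClass C D) := by
  obtain ⟨Φ, ⟨hΦ, cΦ⟩, mΦ⟩ := h1
  obtain ⟨Ψ, ⟨hΨ, cΨ⟩, mΨ⟩ := h2
  refine ⟨{x | (x.1.head? = some false ∧ (x.1.tail, x.2) ∈ Φ) ∨
      (x.1.head? = some true ∧ (x.1.tail, x.2) ∈ Ψ)}, ⟨primrec_head_tail hΦ hΨ, ?_⟩, ?_⟩
  · rintro σ τ σ' τ' hσ hσ' hp
    rcases σ with _ | ⟨b, σ⟩
    · simp at hσ
    rcases σ' with _ | ⟨b', σ'⟩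
    · simp at hσ'
    obtain ⟨rfl, hp'⟩ := List.cons_prefix_cons.1 hp
    cases b
    · simp only [Set.mem_ofPred_eq, List.head?_cons, List.tail_cons, true_and, Option.some.injEq,
        Bool.false_eq_true, false_and, or_false] at hσ hσ'
      exact cΦ _ _ _ _ hσ hσ' hp'
    · simp only [Set.mem_ofPred_eq, List.head?_cons, List.tail_cons, true_and, Option.some.injEq,
        Bool.true_eq_false, false_and, false_or] at hσ hσ'
      exact cΨ _ _ _ _ hσ hσ' hp'
  · rintro _ (⟨X, hX, rfl⟩ | ⟨X, hX, rfl⟩)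
    · obtain ⟨Y, hY, hXY⟩ := mΦ X hX
      refine ⟨Y, hY, fun n => (hXY n).imp id ?_⟩
      rintro ⟨σ, τ, hm, hp, ht⟩
      exact ⟨false :: σ, τ, Or.inl ⟨rfl, hm⟩, prefixOf_cons.2 hp, ht⟩
    · obtain ⟨Y, hY, hXY⟩ := mΨ X hX
      refine ⟨Y, hY, fun n => (hXY n).imp id ?_⟩
      rintro ⟨σ, τ, hm, hp, ht⟩
      exact ⟨true :: σ, τ, Or.inr ⟨rfl, hm⟩, prefixOf_cons.2 hp, ht⟩

theorem isPi01_infClass {C D : Set Cantor} (hC : IsPi01 C) (hD : IsPi01 D) :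
    IsPi01 (infClass C D) := by
  obtain ⟨S, hS, rfl⟩ := hC
  obtain ⟨T, hT, rfl⟩ := hD
  refine ⟨{σ | (σ.head? = some false ∧ σ.tail ∈ S) ∨ (σ.head? = some true ∧ σ.tail ∈ T)}, ?_, ?_⟩
  · exact re_comp (primrec_head_tail (p := fun x => x.1 ∈ S) (q := fun x => x.1 ∈ T)
      (re_comp hS Computable.fst) (re_comp hT Computable.fst))
      (f := fun σ : Str => (σ, ([] : Str))) (Computable.id.pair (Computable.const []))
  · ext X
    obtain ⟨b, X, rfl⟩ : ∃ b Y, consSeq b Y = X := ⟨_, _, consSeq_eta X⟩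
    have inj : ∀ {b b' : Bool} {X Y : Cantor}, consSeq b X = consSeq b' Y → b = b' ∧ X = Y :=
      fun h => ⟨congrFun h 0, funext fun n => congrFun h (n + 1)⟩
    simp only [infClass, Set.mem_union, Set.mem_image, Set.mem_compl_iff, openOf,
      Set.mem_ofPred_eq, not_exists, not_and]
    constructor
    · rintro (⟨Y, hY, h⟩ | ⟨Y, hY, h⟩) σ hσ hp <;> obtain ⟨rfl, rfl⟩ := inj h <;>
        rcases σ with _ | ⟨b, σ⟩
      · simp at hσ
      · have hb : b = false := congrArg (fun l => l.headI) ((restr_consSeq _ _ _).symm.trans hp)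
          |>.symm
        subst hb
        exact hY σ (by simpa using hσ) (prefixOf_cons.1 hp)
      · simp at hσ
      · have hb : b = true := congrArg (fun l => l.headI) ((restr_consSeq _ _ _).symm.trans hp)
          |>.symm
        subst hb
        exact hY σ (by simpa using hσ) (prefixOf_cons.1 hp)
    · intro h
      cases b
      · exact Or.inl ⟨X, fun σ hσ hp => h (false :: σ) (by simpa using hσ)
          (prefixOf_cons.2 hp), rfl⟩
      · exact Or.inr ⟨X, fun σ hσ hp => h (true :: σ) (by simpa using hσ)
          (prefixOf_cons.2 hp), rfl⟩

/-- The bits of `σ` at the positions `b, b + 2, b + 4, …`. -/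
def half (b : ℕ) (σ : Str) : Str :=
  (List.range ((σ.length + 1 - b) / 2)).map fun i => σ.getD (2 * i + b) false

theorem primrec_half (b : ℕ) : Primrec (half b) := by
  unfold half
  refine Primrec.list_map ?_ ?_
  · refine Primrec.list_range.comp (Primrec.nat_div.comp ?_ (Primrec.const 2))
    exact Primrec.nat_sub.comp (Primrec.succ.comp Primrec.list_length) (Primrec.const b)
  · refine (Primrec.list_getD false).comp Primrec.fst ?_
    exact Primrec.nat_add.comp (Primrec.nat_mul.comp (Primrec.const 2) Primrec.snd)
      (Primrec.const b)

theorem half_restr (b : ℕ) (X : Cantor) (n : ℕ) :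
    half b (restr X n) = restr (fun i => X (2 * i + b)) ((n + 1 - b) / 2) := by
  refine List.ext_getElem (by simp [half, restr]) fun i h1 h2 => ?_
  have h3 : i < (n + 1 - b) / 2 := by simpa [restr] using h2
  have h4 : 2 * i + b < n := by omega
  simp [half, restr, h4]

theorem half_prefix (b : ℕ) {σ τ : Str} (h : σ <+: τ) : half b σ <+: half b τ := by
  have hl := h.length_le
  refine prefix_of_getElem ?_ fun i h1 => ?_
  · simp only [half, List.length_map, List.length_range]; omega
  · have h3 : i < (σ.length + 1 - b) / 2 := by simpa [half] using h1
    have h4 : 2 * i + b < σ.length := by omega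
    have h5 : 2 * i + b < τ.length := by omega
    simp [half, h4, h5, h.getElem h4]

theorem medvedevLE_half (b : ℕ) {C D : Set Cantor}
    (h : ∀ X ∈ D, (fun i => X (2 * i + b)) ∈ C) : MedvedevLE C D := by
  refine ⟨{p | p.2 = half b p.1}, ⟨re_of_primrec (Primrec.eq.comp Primrec.snd
    ((primrec_half b).comp Primrec.fst)), ?_⟩, ?_⟩
  · rintro σ τ σ' τ' h1 h2 hσ
    simp only [Set.mem_ofPred_eq] at h1 h2
    subst h1 h2
    exact Or.inl (half_prefix b hσ)
  · refine fun X hX => ⟨_, h X hX, fun n => ?_⟩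
    refine Or.inr ⟨restr X (2 * n + b), half b (restr X (2 * n + b)), rfl, prefixOf_restr X _, ?_⟩
    rw [half_restr]
    exact restr_prefix _ (by omega)

theorem joinSeq_even (X Y : Cantor) : (fun i => joinSeq X Y (2 * i + 0)) = X := by
  funext i; simp [joinSeq]

theorem joinSeq_odd (X Y : Cantor) : (fun i => joinSeq X Y (2 * i + 1)) = Y := by
  funext i
  have h1 : (2 * i + 1) % 2 = 1 := by omega
  have h2 : (2 * i + 1) / 2 = i := by omega
  simp [joinSeq, h1, h2]

theorem joinSeq_eta (X : Cantor) :
    joinSeq (fun i => X (2 * i + 0)) (fun i => X (2 * i + 1)) = X := by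
  funext n
  simp only [joinSeq]
  split_ifs with h <;> congr 1 <;> omega

theorem mem_supClass {C D : Set Cantor} {X : Cantor} :
    X ∈ supClass C D ↔ (fun i => X (2 * i + 0)) ∈ C ∧ (fun i => X (2 * i + 1)) ∈ D := by
  constructor
  · rintro ⟨Y, hY, Z, hZ, rfl⟩
    rw [joinSeq_even, joinSeq_odd]
    exact ⟨hY, hZ⟩
  · rintro ⟨h1, h2⟩
    exact ⟨_, h1, _, h2, joinSeq_eta X⟩

theorem mem_openOf_half (b : ℕ) (S : Set Str) (X : Cantor) :
    (fun i => X (2 * i + b)) ∈ openOf S ↔ X ∈ openOf {σ | half b σ ∈ S} := by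
  constructor
  · rintro ⟨σ, hσ, hp⟩
    refine ⟨restr X (2 * σ.length + b), ?_, prefixOf_restr _ _⟩
    have : (2 * σ.length + b + 1 - b) / 2 = σ.length := by omega
    simp only [Set.mem_ofPred_eq, half_restr, this]
    rwa [show restr _ σ.length = σ from hp]
  · rintro ⟨σ, hσ, hp⟩
    refine ⟨half b σ, hσ, ?_⟩
    rw [← show restr X σ.length = σ from hp, half_restr]
    exact prefixOf_restr _ _

theorem isPi01_supClass {C D : Set Cantor} (hC : IsPi01 C) (hD : IsPi01 D) :
    IsPi01 (supClass C D) := by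
  obtain ⟨S, hS, rfl⟩ := hC
  obtain ⟨T, hT, rfl⟩ := hD
  refine ⟨{σ | half 0 σ ∈ S ∨ half 1 σ ∈ T}, ?_, ?_⟩
  · exact re_or (re_comp hS (primrec_half 0).to_comp) (re_comp hT (primrec_half 1).to_comp)
  · ext X
    rw [mem_supClass, Set.mem_compl_iff, Set.mem_compl_iff, Set.mem_compl_iff,
      mem_openOf_half 0, mem_openOf_half 1, ← not_or]
    simp only [openOf, Set.mem_ofPred_eq, or_and_right, exists_or]

/-- Interleaving of two strings, cut off where the shorter one ends. -/
def weave (σ τ : Str) : Str :=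
  (List.range (2 * min σ.length τ.length)).map fun i =>
    if i % 2 = 0 then σ.getD (i / 2) false else τ.getD (i / 2) false

theorem primrec_weave : Primrec₂ weave := by
  change Primrec fun p : Str × Str => weave p.1 p.2
  unfold weave
  refine Primrec.list_map ?_ ?_
  · refine Primrec.list_range.comp (Primrec.nat_mul.comp (Primrec.const 2) ?_)
    exact Primrec.nat_min.comp (Primrec.list_length.comp Primrec.fst)
      (Primrec.list_length.comp Primrec.snd)
  · change Primrec fun x : (Str × Str) × ℕ =>
      if x.2 % 2 = 0 then x.1.1.getD (x.2 / 2) false else x.1.2.getD (x.2 / 2) false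
    refine Primrec.ite ?_ ?_ ?_
    · exact Primrec.eq.comp (Primrec.nat_mod.comp Primrec.snd (Primrec.const 2)) (Primrec.const 0)
    · exact (Primrec.list_getD false).comp (Primrec.fst.comp Primrec.fst)
        (Primrec.nat_div.comp Primrec.snd (Primrec.const 2))
    · exact (Primrec.list_getD false).comp (Primrec.snd.comp Primrec.fst)
        (Primrec.nat_div.comp Primrec.snd (Primrec.const 2))

theorem comparable_weave {σ σ' τ τ' : Str} (h1 : Comparable σ σ') (h2 : Comparable τ τ') :
    Comparable (weave σ τ) (weave σ' τ') := by
  rw [comparable_iff] at h1 h2 ⊢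
  intro i hi hi'
  have h3 : i < 2 * min σ.length τ.length := by simpa [weave] using hi
  have h4 : i < 2 * min σ'.length τ'.length := by simpa [weave] using hi'
  have a1 : i / 2 < σ.length := by omega
  have a2 : i / 2 < σ'.length := by omega
  have a3 : i / 2 < τ.length := by omega
  have a4 : i / 2 < τ'.length := by omega
  simp [weave, a1, a2, a3, a4, h1 _ a1 a2, h2 _ a3 a4]

theorem restr_joinSeq_prefix {A B : Cantor} {n : ℕ} {σ τ : Str} (h1 : restr A n <+: σ)
    (h2 : restr B n <+: τ) : restr (joinSeq A B) n <+: weave σ τ := by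
  have l1 : n ≤ σ.length := by simpa [length_restr] using h1.length_le
  have l2 : n ≤ τ.length := by simpa [length_restr] using h2.length_le
  refine prefix_of_getElem ?_ fun i hi => ?_
  · simp only [length_restr, weave, List.length_map, List.length_range]; omega
  · rw [length_restr] at hi
    have a1 : i / 2 < (restr A n).length := by rw [length_restr]; omega
    have a2 : i / 2 < (restr B n).length := by rw [length_restr]; omega
    have b1 : i / 2 < σ.length := by omega
    have b2 : i / 2 < τ.length := by omega
    have e1 := h1.getElem a1
    have e2 := h2.getElem a2
    simp only [restr, List.getElem_map, List.getElem_range] at e1 e2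
    simp [restr, weave, joinSeq, b1, b2, ← e1, ← e2]

theorem supClass_le {C D E : Set Cantor} (h1 : MedvedevLE C E) (h2 : MedvedevLE D E) :
    MedvedevLE (supClass C D) E := by
  obtain ⟨Φ, ⟨hΦ, cΦ⟩, mΦ⟩ := h1
  obtain ⟨Ψ, ⟨hΨ, cΨ⟩, mΨ⟩ := h2
  refine ⟨{p | ∃ q r : Str × Str, q ∈ Φ ∧ r ∈ Ψ ∧ q.1 <+: p.1 ∧ r.1 <+: p.1 ∧
    p.2 = weave q.2 r.2}, ⟨?_, ?_⟩, ?_⟩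
  · refine re_exists (p := fun (p q : Str × Str) => ∃ r : Str × Str, q ∈ Φ ∧ r ∈ Ψ ∧
      q.1 <+: p.1 ∧ r.1 <+: p.1 ∧ p.2 = weave q.2 r.2) ?_
    refine re_exists (p := fun (x : (Str × Str) × (Str × Str)) (r : Str × Str) =>
      x.2 ∈ Φ ∧ r ∈ Ψ ∧ x.2.1 <+: x.1.1 ∧ r.1 <+: x.1.1 ∧ x.1.2 = weave x.2.2 r.2) ?_
    have f1 : Primrec fun y : ((Str × Str) × (Str × Str)) × (Str × Str) => y.1.1 :=
      Primrec.fst.comp Primrec.fst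
    have f2 : Primrec fun y : ((Str × Str) × (Str × Str)) × (Str × Str) => y.1.2 :=
      Primrec.snd.comp Primrec.fst
    have f3 : Primrec fun y : ((Str × Str) × (Str × Str)) × (Str × Str) => y.2 := Primrec.snd
    refine re_and (re_comp hΦ f2.to_comp) (re_and (re_comp hΨ f3.to_comp)
      (re_and (re_of_primrec ?_) (re_and (re_of_primrec ?_) (re_of_primrec ?_))))
    · exact primrec_prefix (Primrec.fst.comp f2) (Primrec.fst.comp f1)
    · exact primrec_prefix (Primrec.fst.comp f3) (Primrec.fst.comp f1)
    · exact Primrec.eq.comp (Primrec.snd.comp f1)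
        (primrec_weave.comp (Primrec.snd.comp f2) (Primrec.snd.comp f3))
  · rintro σ τ σ' τ' ⟨⟨q1, q2⟩, ⟨r1, r2⟩, hq, hr, pq, pr, rfl⟩
      ⟨⟨q1', q2'⟩, ⟨r1', r2'⟩, hq', hr', pq', pr', rfl⟩ hσ
    have hc : Comparable σ σ' := Or.inl hσ
    exact comparable_weave (cΦ.comparable hq hq' (hc.of_prefix pq pq'))
      (cΨ.comparable hr hr' (hc.of_prefix pr pr'))
  · intro X hX
    obtain ⟨A, hA, mA⟩ := mΦ X hX
    obtain ⟨B, hB, mB⟩ := mΨ X hX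
    refine ⟨joinSeq A B, ⟨A, hA, B, hB, rfl⟩, fun n => ?_⟩
    rcases mA n with h | ⟨σ, τ, hm, hp, ht⟩
    · left
      have : n = 0 := by simpa [length_restr] using congrArg List.length h
      subst this; rfl
    rcases mB n with h | ⟨σ', τ', hm', hp', ht'⟩
    · left
      have : n = 0 := by simpa [length_restr] using congrArg List.length h
      subst this; rfl
    refine Or.inr ⟨restr X (max σ.length σ'.length), weave τ τ',
      ⟨(σ, τ), (σ', τ'), hm, hm', ?_, ?_, rfl⟩, prefixOf_restr _ _, restr_joinSeq_prefix ht ht'⟩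
    · have := restr_prefix X (le_max_left σ.length σ'.length)
      rwa [show restr X σ.length = σ from hp] at this
    · have := restr_prefix X (le_max_right σ.length σ'.length)
      rwa [show restr X σ'.length = σ' from hp'] at this

/-! ### The lattice of Medvedev degrees of `Π⁰₁` classes -/

/-- The type of `Π⁰₁` classes. -/
structure Pi01Class where
  carrier : Set Cantor
  isPi01 : IsPi01 carrier

namespace Pi01Class

/-- `Π⁰₁` classes are preordered by Medvedev reducibility. -/
instance : Preorder Pi01Class where
  le C D := MedvedevLE C.carrier D.carrier
  le_refl C := medvedevLE_refl C.carrier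
  le_trans _ _ _ := medvedevLE_trans

/-- The `Π⁰₁` class `inf(C, D)`. -/
def inf (C D : Pi01Class) : Pi01Class :=
  ⟨infClass C.carrier D.carrier, isPi01_infClass C.isPi01 D.isPi01⟩

/-- The `Π⁰₁` class `sup(C, D)`. -/
def sup (C D : Pi01Class) : Pi01Class :=
  ⟨supClass C.carrier D.carrier, isPi01_supClass C.isPi01 D.isPi01⟩

theorem inf_le_left (C D : Pi01Class) : inf C D ≤ C :=
  medvedevLE_cons false Set.subset_union_left

theorem inf_le_right (C D : Pi01Class) : inf C D ≤ D :=
  medvedevLE_cons true Set.subset_union_right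

theorem le_inf {C D E : Pi01Class} (h1 : E ≤ C) (h2 : E ≤ D) : E ≤ inf C D := le_infClass h1 h2

theorem le_sup_left (C D : Pi01Class) : C ≤ sup C D :=
  medvedevLE_half 0 fun _ hX => (mem_supClass.1 hX).1

theorem le_sup_right (C D : Pi01Class) : D ≤ sup C D :=
  medvedevLE_half 1 fun _ hX => (mem_supClass.1 hX).2

theorem sup_le {C D E : Pi01Class} (h1 : C ≤ E) (h2 : D ≤ E) : sup C D ≤ E := supClass_le h1 h2

end Pi01Class

/-- The Medvedev degrees of `Π⁰₁` classes: the quotient of the preorder of `Π⁰₁` classes by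
Medvedev equivalence, with the induced order. -/
abbrev MedvedevDegree : Type := Antisymmetrization Pi01Class (· ≤ ·)

/-- The Medvedev degree of a `Π⁰₁` class. -/
def degree (C : Pi01Class) : MedvedevDegree := toAntisymmetrization (· ≤ ·) C

/-- The lattice `E_s`; its operations are induced by `inf` and `sup` of classes. -/
instance : Lattice MedvedevDegree where
  inf := Quotient.map₂ Pi01Class.inf fun _ _ h _ _ h' =>
    ⟨Pi01Class.le_inf ((Pi01Class.inf_le_left _ _).trans h.1)
        ((Pi01Class.inf_le_right _ _).trans h'.1),
      Pi01Class.le_inf ((Pi01Class.inf_le_left _ _).trans h.2)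
        ((Pi01Class.inf_le_right _ _).trans h'.2)⟩
  sup := Quotient.map₂ Pi01Class.sup fun _ _ h _ _ h' =>
    ⟨Pi01Class.sup_le (h.1.trans (Pi01Class.le_sup_left _ _))
        (h'.1.trans (Pi01Class.le_sup_right _ _)),
      Pi01Class.sup_le (h.2.trans (Pi01Class.le_sup_left _ _))
        (h'.2.trans (Pi01Class.le_sup_right _ _))⟩
  inf_le_left a b := Quotient.inductionOn₂ a b Pi01Class.inf_le_left
  inf_le_right a b := Quotient.inductionOn₂ a b Pi01Class.inf_le_right
  le_inf a b c := Quotient.inductionOn₃ a b c fun _ _ _ => Pi01Class.le_inf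
  le_sup_left a b := Quotient.inductionOn₂ a b Pi01Class.le_sup_left
  le_sup_right a b := Quotient.inductionOn₂ a b Pi01Class.le_sup_right
  sup_le a b c := Quotient.inductionOn₃ a b c fun _ _ _ => Pi01Class.sup_le

/-- A filter in a lattice: a subset which is closed upwards and closed under `inf`. -/
def IsLatticeFilter {L : Type} [Lattice L] (F : Set L) : Prop :=
  (∀ x y : L, x ∈ F → x ≤ y → y ∈ F) ∧ ∀ x y : L, x ∈ F → y ∈ F → x ⊓ y ∈ F

/-- The Medvedev degrees of deep `Π⁰₁` classes. -/
def deepDegrees : Set MedvedevDegree := {d | ∃ C : Pi01Class, IsDeep C.carrier ∧ degree C = d}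

end DeepClasses

/-! Since `levelMass` decreases along the levels, depth amounts to being able to compute, for each
`k`, a level of a priori probability at most `2⁻ᵏ` (`isDeep_iff`). In this form a constant factor `2
^ c` only shifts `k`.

Upward closure: let `Φ` map `D` into `C`. By compactness, for each `n` there is a level of the tree
of `D` on which every string makes `Φ` produce at least `n` bits. Such a level `u n` can be computed
although the tree is only co-c.e., because it suffices to see each string either leave `D` or yield
enough output (`exists_computable_use`). An oracle from which the universal functional computes a
string on level `u n` of `D` lets the composite with `Φ` compute a string on level `n` of `C`. The
universal functional simulates that composite at the cost of a fixed prefix, so `M(D_{u n}) ≤ 2 ^ c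
* M(C_n)` with `c` independent of `n` (`exists_tsum_aprioriM_le`).

Infimum: deleting the first bit sends level `n + 1` of `inf(C, D)` into the union of the `n`-th
levels of `C` and `D`, and the same domination applies. -/

namespace DeepClasses

/-! ### Computably enumerable predicates: stages, bounded quantifiers, uniform selection. -/

section Computability

variable {α : Type} [Primcodable α]

/-- Compared with `re_normal`, monotonicity in the stage lets finitely many instances share one
stage, and primitive recursiveness lets that shared stage be checked by a bounded quantifier. -/
theorem re_normal_primrec {p : α → Prop} (hp : REPred p) :
    ∃ f : α → ℕ → Bool, Primrec₂ f ∧ (∀ a m n, m ≤ n → f a m = true → f a n = true) ∧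
      ∀ a, p a ↔ ∃ n, f a n = true := by
  obtain ⟨c, hc⟩ := Nat.Partrec.Code.exists_code.1 hp
  refine ⟨fun a n => (Nat.Partrec.Code.evaln n c (Encodable.encode a)).isSome, ?_, ?_, ?_⟩
  · change Primrec fun x : α × ℕ =>
      (Nat.Partrec.Code.evaln x.2 c (Encodable.encode x.1)).isSome
    refine Primrec.option_isSome.comp ?_
    exact Nat.Partrec.Code.primrec_evaln.comp
      ((Primrec.snd.pair (Primrec.const c)).pair (Primrec.encode.comp Primrec.fst))
  · intro a m n hmn h
    obtain ⟨x, hx⟩ := Option.isSome_iff_exists.1 h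
    exact Option.isSome_iff_exists.2 ⟨x, Nat.Partrec.Code.evaln_mono hmn hx⟩
  · intro a
    have h1 : p a ↔ (c.eval (Encodable.encode a)).Dom := by
      rw [hc]; simp [Part.assert]
    rw [h1, Part.dom_iff_mem]
    simp only [Nat.Partrec.Code.evaln_complete, Option.isSome_iff_exists, Option.mem_def]
    exact exists_comm

/-- The list of all strings of length `n`. -/
def stringsOfLength : ℕ → List Str
  | 0 => [[]]
  | n + 1 => (stringsOfLength n).map (List.cons false) ++ (stringsOfLength n).map (List.cons true)

theorem mem_stringsOfLength {n : ℕ} {σ : Str} : σ ∈ stringsOfLength n ↔ σ.length = n := by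
  induction n generalizing σ with
  | zero => simp [stringsOfLength]
  | succ n ih =>
    rcases σ with _ | ⟨b, σ⟩
    · simp [stringsOfLength]
    · cases b <;> simp [stringsOfLength, ih]

theorem primrec_stringsOfLength : Primrec stringsOfLength := by
  have hc (b : Bool) : Primrec fun x : ℕ × List Str => x.2.map (List.cons b) :=
    Primrec.list_map Primrec.snd (Primrec.list_cons.comp (Primrec.const b) Primrec.snd)
  refine (Primrec.nat_rec₁ [[]] (f := fun (_ : ℕ) (L : List Str) =>
    L.map (List.cons false) ++ L.map (List.cons true))
    (Primrec.list_append.comp (hc false) (hc true))).of_eq fun n => ?_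
  induction n with
  | zero => rfl
  | succ n ih => simp only [stringsOfLength, ← ih]

/-- Only finitely many strings have a given length, so if all of them are enumerated, they are all
enumerated by some common stage. -/
theorem re_forall_length {p : α → Str → Prop} (hp : REPred fun x : α × Str => p x.1 x.2) :
    REPred fun x : α × ℕ => ∀ σ : Str, σ.length = x.2 → p x.1 σ := by
  obtain ⟨f, hf, hmono, hfp⟩ := re_normal_primrec hp
  have hR : PrimrecRel fun (σ : Str) (y : α × ℕ) => f (y.1, σ) y.2 = true := by
    refine Primrec.eq.comp (hf.comp ?_ ?_) (Primrec.const true)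
    · exact (Primrec.fst.comp Primrec.snd).pair Primrec.fst
    · exact Primrec.snd.comp Primrec.snd
  have h2 := hR.forall_mem_list
  have h3 : PrimrecPred fun z : (α × ℕ) × ℕ =>
      ∀ σ ∈ stringsOfLength z.1.2, f (z.1.1, σ) z.2 = true :=
    PrimrecRel.comp h2
      (f := fun z : (α × ℕ) × ℕ => stringsOfLength z.1.2)
      (g := fun z : (α × ℕ) × ℕ => (z.1.1, z.2))
      (primrec_stringsOfLength.comp (Primrec.snd.comp Primrec.fst))
      ((Primrec.fst.comp Primrec.fst).pair Primrec.snd)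
  refine (re_exists (p := fun (x : α × ℕ) (t : ℕ) =>
    ∀ σ ∈ stringsOfLength x.2, f (x.1, σ) t = true) (re_of_primrec h3)).of_eq fun x => ?_
  simp only [mem_stringsOfLength]
  constructor
  · rintro ⟨t, ht⟩ σ hσ
    exact (hfp (x.1, σ)).2 ⟨t, ht σ hσ⟩
  · intro h
    choose! g hg using fun σ hσ => (hfp (x.1, σ)).1 (h σ hσ)
    obtain ⟨t, ht⟩ : ∃ t, ∀ σ ∈ stringsOfLength x.2, g σ ≤ t :=
      ⟨((stringsOfLength x.2).map g).sum,
        fun σ hσ => List.single_le_sum (by simp) _ (List.mem_map_of_mem hσ)⟩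
    exact ⟨t, fun σ hσ => hmono _ _ _ (ht σ (mem_stringsOfLength.2 hσ)) (hg σ hσ)⟩

/-- The search runs over coded pairs (value, stage) and returns the value of the first confirmed
pair, which need not be the least value satisfying `p a`. -/
theorem exists_computable_choice {p : α → ℕ → Prop} (hp : REPred fun x : α × ℕ => p x.1 x.2)
    (h : ∀ a, ∃ n, p a n) : ∃ u : α → ℕ, Computable u ∧ ∀ a, p a (u a) := by
  obtain ⟨f, hf, hfp⟩ := re_normal hp
  have h' : ∀ a, ∃ k : ℕ, f (a, k.unpair.1) k.unpair.2 = true := fun a => by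
    obtain ⟨n, hn⟩ := h a
    obtain ⟨t, ht⟩ := (hfp (a, n)).1 hn
    exact ⟨Nat.pair n t, by simpa using ht⟩
  refine ⟨fun a => (Nat.find (h' a)).unpair.1, ?_, fun a => (hfp _).2 ⟨_, Nat.find_spec (h' a)⟩⟩
  have hg : Computable₂ fun (a : α) (k : ℕ) => f (a, k.unpair.1) k.unpair.2 := by
    have hu : Computable fun x : α × ℕ => x.2.unpair := Computable.unpair.comp Computable.snd
    exact hf.comp (Computable.fst.pair (Computable.fst.comp hu)) (Computable.snd.comp hu)
  have hfind : Computable fun a => Nat.find (h' a) := by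
    refine Partrec.of_eq (Partrec.rfind (Computable₂.partrec₂ hg)) fun a => ?_
    refine Part.eq_some_iff.2 (Nat.mem_rfind.2 ⟨?_, fun {m} hm => ?_⟩)
    · simpa using Nat.find_spec (h' a)
    · simpa using Nat.find_min (h' a) hm
  exact Computable.fst.comp (Computable.unpair.comp hfind)

end Computability

/-! ### The universal functional -/

theorem primrecRel_comparable : PrimrecRel Comparable :=
  (primrec_prefix Primrec.fst Primrec.snd).or (primrec_prefix Primrec.snd Primrec.fst)

theorem primrec_candidate : Primrec₂ candidate := by
  change Primrec fun x : ℕ × ℕ => candidate x.1 x.2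
  unfold candidate
  have hu : Primrec fun x : ℕ × ℕ => x.2.unpair := Primrec.unpair.comp Primrec.snd
  refine Primrec.option_bind ?_ ?_
  · exact Nat.Partrec.Code.primrec_evaln.comp
      (((Primrec.snd.comp hu).pair ((Primrec.ofNat _).comp Primrec.fst)).pair
        (Primrec.fst.comp hu))
  · exact Primrec.decode.comp (Primrec.fst.comp (hu.comp Primrec.fst))

/-- One step of the acceptance procedure. -/
def acceptStep (L : List (Str × Str)) (o : Option (Str × Str)) : List (Str × Str) :=
  o.elim L fun p => if ∀ q ∈ L, Comparable p.1 q.1 → Comparable p.2 q.2 then p :: L else L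

theorem accepted_succ (e s : ℕ) :
    accepted e (s + 1) = acceptStep (accepted e s) (candidate e s) := by
  rw [accepted]
  cases candidate e s <;> rfl

theorem primrec_acceptStep : Primrec₂ acceptStep := by
  have hR : PrimrecRel fun (q p : Str × Str) => Comparable p.1 q.1 → Comparable p.2 q.2 := by
    have h1 : PrimrecRel fun (q p : Str × Str) => Comparable p.1 q.1 :=
      primrecRel_comparable.comp (Primrec.fst.comp Primrec.snd) (Primrec.fst.comp Primrec.fst)
    have h2 : PrimrecRel fun (q p : Str × Str) => Comparable p.2 q.2 :=
      primrecRel_comparable.comp (Primrec.snd.comp Primrec.snd) (Primrec.snd.comp Primrec.fst)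
    exact PrimrecPred.of_eq (PrimrecPred.or (PrimrecPred.not h1) h2) fun x => imp_iff_not_or.symm
  have h3 : Primrec₂ fun (x : List (Str × Str) × Option (Str × Str)) (p : Str × Str) =>
      if ∀ q ∈ x.1, Comparable p.1 q.1 → Comparable p.2 q.2 then p :: x.1 else x.1 := by
    have hL : Primrec fun y : (List (Str × Str) × Option (Str × Str)) × (Str × Str) => y.1.1 :=
      Primrec.fst.comp Primrec.fst
    exact Primrec.ite (hR.forall_mem_list.comp hL Primrec.snd)
      (Primrec.list_cons.comp Primrec.snd hL) hL
  refine (Primrec.option_casesOn Primrec.snd Primrec.fst h3).of_eq fun x => ?_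
  rcases x with ⟨L, _ | p⟩ <;> rfl

theorem primrec_accepted : Primrec₂ accepted := by
  refine (Primrec.nat_rec (f := fun _ : ℕ => ([] : List (Str × Str)))
    (g := fun (e : ℕ) (y : ℕ × List (Str × Str)) => acceptStep y.2 (candidate e y.1))
    (Primrec.const _) (primrec_acceptStep.comp (Primrec.snd.comp Primrec.snd)
      (primrec_candidate.comp Primrec.fst (Primrec.fst.comp Primrec.snd)))).of_eq fun e s => ?_
  induction s with
  | zero => rfl
  | succ s ih => rw [accepted_succ, ← ih]

theorem accepted_mono (e : ℕ) {s t : ℕ} (h : s ≤ t) {p : Str × Str} (hp : p ∈ accepted e s) :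
    p ∈ accepted e t := by
  induction t, h using Nat.le_induction with
  | base => exact hp
  | succ t _ ih =>
    rw [accepted_succ, acceptStep]
    rcases candidate e t with _ | q
    · exact ih
    · simp only [Option.elim_some]
      split_ifs
      · exact List.mem_cons_of_mem _ ih
      · exact ih

theorem comparable_of_mem_accepted (e s : ℕ) {p q : Str × Str} (hp : p ∈ accepted e s)
    (hq : q ∈ accepted e s) (h : Comparable p.1 q.1) : Comparable p.2 q.2 := by
  induction s generalizing p q with
  | zero => simp [accepted] at hp
  | succ s ih =>
    rw [accepted_succ, acceptStep] at hp hq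
    rcases hr : candidate e s with _ | r
    · rw [hr] at hp hq
      exact ih hp hq h
    · simp only [hr, Option.elim_some] at hp hq
      split_ifs at hp hq with hc
      · rcases List.mem_cons.1 hp with rfl | hp' <;> rcases List.mem_cons.1 hq with rfl | hq'
        · exact Or.inl (List.prefix_refl _)
        · exact hc q hq' h
        · exact (hc p hp' h.symm).symm
        · exact ih hp' hq' h
      · exact ih hp hq h

theorem consistent_functional (e : ℕ) : Consistent (functional e) := by
  rintro σ τ σ' τ' ⟨s, hs⟩ ⟨t, ht⟩ h
  exact comparable_of_mem_accepted e (max s t) (accepted_mono e (le_max_left s t) hs)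
    (accepted_mono e (le_max_right s t) ht) (Or.inl h)

/-- The strings `1^e 0` form a prefix-free code, so pairs coming from different indices never have
comparable inputs, and consistency of the universal functional reduces to that of each `functional
e`. -/
theorem replicate_false_prefix {e e' : ℕ} {σ σ' : Str}
    (h : List.replicate e true ++ false :: σ <+: List.replicate e' true ++ false :: σ') :
    e = e' ∧ σ <+: σ' := by
  induction e generalizing e' with
  | zero =>
    cases e' with
    | zero => simpa using h
    | succ e' => simp [List.replicate_succ] at h
  | succ e ih =>
    cases e' with
    | zero => simp [List.replicate_succ] at h
    | succ e' =>
      simp only [List.replicate_succ, List.cons_append, List.cons_prefix_cons, true_and] at h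
      exact ⟨congrArg _ (ih h).1, (ih h).2⟩

theorem isTuringFunctional_universal : IsTuringFunctional universalFunctional := by
  constructor
  · refine REPred.of_eq (re_exists (p := fun (p : Str × Str) (y : ℕ × ℕ × Str) =>
      (∃ q ∈ accepted y.1 y.2.1, q = (y.2.2, p.2)) ∧
        p.1 = List.replicate y.1 true ++ false :: y.2.2) (re_of_primrec ?_)) fun p => ?_
    · have hy : Primrec fun x : (Str × Str) × (ℕ × ℕ × Str) => x.2 := Primrec.snd
      have hp : Primrec fun x : (Str × Str) × (ℕ × ℕ × Str) => x.1 := Primrec.fst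
      have he := Primrec.fst.comp hy
      have hs := Primrec.fst.comp (Primrec.snd.comp hy)
      have hσ := Primrec.snd.comp (Primrec.snd.comp hy)
      have hrep : Primrec fun n : ℕ => List.replicate n true :=
        (Primrec.list_map Primrec.list_range (Primrec.const true).to₂).of_eq fun n => by simp
      have hex : PrimrecRel fun (q r : Str × Str) => q = r := Primrec.eq
      refine PrimrecPred.and ?_ ?_
      · exact hex.exists_mem_list.comp (primrec_accepted.comp he hs)
          (hσ.pair (Primrec.snd.comp hp))
      · exact Primrec.eq.comp (Primrec.fst.comp hp)
          (Primrec.list_append.comp (hrep.comp he)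
            (Primrec.list_cons.comp (Primrec.const false) hσ))
    · constructor
      · rintro ⟨⟨e, s, σ⟩, ⟨_, hq, rfl⟩, h⟩
        exact ⟨e, σ, ⟨s, hq⟩, h⟩
      · rintro ⟨e, σ, ⟨s, hs⟩, h⟩
        exact ⟨(e, s, σ), ⟨_, hs, rfl⟩, h⟩
  · rintro _ τ _ τ' ⟨e, σ, h1, rfl⟩ ⟨e', σ', h2, rfl⟩ h
    obtain ⟨rfl, hσ⟩ := replicate_false_prefix h
    exact consistent_functional e _ _ _ _ h1 h2 hσ

/-- `candidate` runs a program on a number and then decodes that number. To conclude that the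
program halts on the code of the decoded pair, decoding must be injective where defined; this is
shown for `Bool`, then strings, then pairs. -/
theorem eq_encode_of_decode_bool {n : ℕ} {b : Bool}
    (h : (Encodable.decode n : Option Bool) = some b) : n = Encodable.encode b := by
  rcases n with _ | _ | n
  · rw [Encodable.decode_zero] at h; cases h; rfl
  · rw [Encodable.decode_one] at h; cases h; rfl
  · rw [Encodable.decode_ge_two _ (by omega)] at h; cases h

theorem eq_encode_of_decode_str {n : ℕ} {σ : Str}
    (h : (Encodable.decode n : Option Str) = some σ) : n = Encodable.encode σ := by
  induction σ generalizing n with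
  | nil =>
    rcases n with _ | n
    · rfl
    · rw [Encodable.decode_list_succ] at h
      rcases hb : (Encodable.decode n.unpair.1 : Option Bool) with _ | b <;>
        rcases hl : (Encodable.decode n.unpair.2 : Option Str) with _ | l <;>
          simp [hb, hl, Seq.seq] at h
  | cons b σ ih =>
    rcases n with _ | n
    · simp at h
    · rw [Encodable.decode_list_succ] at h
      rcases hb : (Encodable.decode n.unpair.1 : Option Bool) with _ | b' <;>
        rcases hl : (Encodable.decode n.unpair.2 : Option Str) with _ | l <;>
          simp [hb, hl, Seq.seq] at h
      obtain ⟨rfl, rfl⟩ := h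
      rw [Encodable.encode_list_cons, ← eq_encode_of_decode_bool hb, ← ih hl, Nat.pair_unpair]

theorem eq_encode_of_decode_strPair {n : ℕ} {p : Str × Str}
    (h : (Encodable.decode n : Option (Str × Str)) = some p) : n = Encodable.encode p := by
  rw [Encodable.decode_prod_val] at h
  rcases h1 : (Encodable.decode n.unpair.1 : Option Str) with _ | σ <;>
    rcases h2 : (Encodable.decode n.unpair.2 : Option Str) with _ | τ <;>
      simp [h1, h2] at h
  subst h
  rw [Encodable.encode_prod_val, ← eq_encode_of_decode_str h1, ← eq_encode_of_decode_str h2,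
    Nat.pair_unpair]

/-- The index is a program semideciding `Φ`. Everything accepted lies in `Φ`, so by consistency of
`Φ` the acceptance test never rejects a candidate. -/
theorem exists_functional_eq {Φ : Set (Str × Str)} (h : IsTuringFunctional Φ) :
    ∃ e, functional e = Φ := by
  obtain ⟨hre, hcons⟩ := h
  obtain ⟨c, hc⟩ := Nat.Partrec.Code.exists_code.1 hre
  have hdom (p : Str × Str) : p ∈ Φ ↔ ∃ k,
      (Nat.Partrec.Code.evaln k c (Encodable.encode p)).isSome := by
    have h1 : p ∈ Φ ↔ (c.eval (Encodable.encode p)).Dom := by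
      rw [hc]; simp [Part.assert]
    rw [h1, Part.dom_iff_mem]
    simp only [Nat.Partrec.Code.evaln_complete, Option.isSome_iff_exists, Option.mem_def]
    exact exists_comm
  have hcode : Denumerable.ofNat Nat.Partrec.Code (Encodable.encode c) = c := by simp
  have hcand (s : ℕ) (p : Str × Str) (h : candidate (Encodable.encode c) s = some p) : p ∈ Φ := by
    rw [candidate, hcode, Option.bind_eq_some_iff] at h
    obtain ⟨x, hx, hd⟩ := h
    have hk : s.unpair.1 = Encodable.encode p := eq_encode_of_decode_strPair hd
    exact (hdom p).2 ⟨s.unpair.2, Option.isSome_iff_exists.2 ⟨x, by rw [← hk]; exact hx⟩⟩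
  have hsub (s : ℕ) (p : Str × Str) (hp : p ∈ accepted (Encodable.encode c) s) : p ∈ Φ := by
    induction s with
    | zero => simp [accepted] at hp
    | succ s ih =>
      rw [accepted_succ, acceptStep] at hp
      rcases hq : candidate (Encodable.encode c) s with _ | q
      · rw [hq] at hp; exact ih hp
      · simp only [hq, Option.elim_some] at hp
        split_ifs at hp
        · rcases List.mem_cons.1 hp with rfl | hp
          · exact hcand s _ hq
          · exact ih hp
        · exact ih hp
  refine ⟨Encodable.encode c, Set.ext fun p => ⟨fun ⟨s, hs⟩ => hsub s p hs, fun hp => ?_⟩⟩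
  obtain ⟨k, hk⟩ := (hdom p).1 hp
  obtain ⟨x, hx⟩ := Option.isSome_iff_exists.1 hk
  -- This stage runs the program on the code of `p` with bound `k`, where it is known to halt.
  have hq : candidate (Encodable.encode c) (Nat.pair (Encodable.encode p) k) = some p := by
    simp [candidate, hx]
  refine ⟨Nat.pair (Encodable.encode p) k + 1, ?_⟩
  rw [accepted_succ, hq, acceptStep, Option.elim_some, if_pos]
  · exact List.mem_cons_self
  · exact fun q hq h => hcons.comparable hp (hsub _ q hq) h

/-! ### Measure -/

open MeasureTheory

theorem measurableSet_prefixOf (σ : Str) : MeasurableSet {X | PrefixOf σ X} := by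
  have : {X | PrefixOf σ X} = ⋂ i : Fin σ.length, (fun X : Cantor => X i) ⁻¹' {σ[i]} := by
    ext X
    simp only [Set.mem_ofPred_eq, prefixOf_iff, Set.mem_iInter, Set.mem_preimage,
      Set.mem_singleton_iff]
    exact ⟨fun h i => (h i i.2).symm, fun h i hi => (h ⟨i, hi⟩).symm⟩
  rw [this]
  exact MeasurableSet.iInter fun i => measurable_pi_apply _ (measurableSet_singleton _)

theorem measurableSet_outputs (Φ : Set (Str × Str)) (τ : Str) :
    MeasurableSet {X | Outputs Φ X τ} := by
  have : {X | Outputs Φ X τ} = {_X | τ = []} ∪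
      ⋃ p : Str × Str, ({_X | p ∈ Φ ∧ τ <+: p.2} ∩ {X | PrefixOf p.1 X}) := by
    ext X
    simp only [Outputs, Set.mem_ofPred_eq, Set.mem_union, Set.mem_iUnion, Set.mem_inter_iff,
      Prod.exists]
    exact or_congr Iff.rfl (exists_congr fun σ => exists_congr fun τ' => by tauto)
  rw [this]
  exact (MeasurableSet.const _).union
    (MeasurableSet.iUnion fun p => (MeasurableSet.const _).inter (measurableSet_prefixOf _))

theorem measurable_consSeq (b : Bool) : Measurable (consSeq b) := by
  refine measurable_pi_lambda _ fun n => ?_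
  cases n with
  | zero => exact measurable_const
  | succ n => exact measurable_pi_apply n

/-- The first toss is fair and independent of the rest. It is enough to compare the two measures on
boxes with finitely many constrained coordinates, which determine the product measure. -/
theorem fairCoin_eq_map_consSeq :
    fairCoin = (2⁻¹ : ℝ≥0∞) • (fairCoin.map (consSeq false) + fairCoin.map (consSeq true)) := by
  classical
  symm
  refine Measure.eq_infinitePi _ fun s t ht => ?_
  -- Prepending `b` turns the constraint at coordinate `0` into a condition on `b` alone and shifts
  -- the other constraints down by one.
  have hpre (b : Bool) : consSeq b ⁻¹' (Set.pi s t) =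
      {_X | 0 ∈ s → b ∈ t 0} ∩
        Set.pi ((s.erase 0).image Nat.pred) fun n => t (n + 1) := by
    ext X
    simp only [Set.mem_preimage, Set.mem_pi, Finset.mem_coe, Set.mem_inter_iff, Set.mem_ofPred_eq,
      Finset.mem_image, Finset.mem_erase]
    constructor
    · intro h
      refine ⟨fun h0 => h 0 h0, ?_⟩
      rintro _ ⟨_ | n, ⟨h0, hn⟩, rfl⟩
      · exact absurd rfl h0
      · exact h _ hn
    · rintro ⟨h0, h⟩ (_ | n) hn
      · exact h0 hn
      · exact h n ⟨n + 1, ⟨by simp, hn⟩, rfl⟩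
  have hprod : ∏ n ∈ (s.erase 0).image Nat.pred,
      (PMF.uniformOfFintype Bool).toMeasure (t (n + 1)) =
      ∏ n ∈ s.erase 0, (PMF.uniformOfFintype Bool).toMeasure (t n) := by
    rw [Finset.prod_image]
    · refine Finset.prod_congr rfl fun n hn => ?_
      rw [Nat.pred_eq_sub_one, Nat.sub_add_cancel (Nat.pos_of_ne_zero (Finset.mem_erase.1 hn).1)]
    · intro a ha b hb hab
      have ha' := (Finset.mem_erase.1 ha).1
      have hb' := (Finset.mem_erase.1 hb).1
      simp only [Nat.pred_eq_sub_one] at hab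
      omega
  have hval (b : Bool) : fairCoin (consSeq b ⁻¹' (Set.pi s t)) =
      (if 0 ∈ s → b ∈ t 0 then 1 else 0) *
        ∏ n ∈ s.erase 0, (PMF.uniformOfFintype Bool).toMeasure (t n) := by
    rw [hpre, ← hprod]
    split_ifs with h
    · rw [Set.eq_univ_of_forall (s := {_X : Cantor | 0 ∈ s → b ∈ t 0}) fun _ => h,
        Set.univ_inter, one_mul]
      exact Measure.infinitePi_pi (fun _ : ℕ => (PMF.uniformOfFintype Bool).toMeasure)
        fun i _ => ht _
    · rw [Set.eq_empty_of_forall_notMem (s := {_X : Cantor | 0 ∈ s → b ∈ t 0}) fun _ => h,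
        Set.empty_inter, measure_empty, zero_mul]
  have hpi : MeasurableSet (Set.pi (s : Set ℕ) t) :=
    MeasurableSet.pi s.countable_toSet fun i _ => ht i
  rw [Measure.smul_apply, Measure.add_apply, Measure.map_apply (measurable_consSeq _) hpi,
    Measure.map_apply (measurable_consSeq _) hpi, hval, hval, ← add_mul, smul_eq_mul, ← mul_assoc]
  -- If coordinate `0` is constrained, its factor is the average of the two indicators of `t 0`;
  -- otherwise both halves give the full product.
  by_cases h0 : 0 ∈ s
  · rw [← Finset.mul_prod_erase s _ h0]
    congr 1
    rw [PMF.toMeasure_apply_fintype]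
    simp only [h0, true_imp_iff, Fintype.sum_bool, Set.indicator, PMF.uniformOfFintype_apply,
      Fintype.card_bool, Nat.cast_ofNat]
    split_ifs <;> simp [mul_add]
  · rw [Finset.erase_eq_of_notMem h0]
    simp only [h0, false_imp_iff, if_true]
    rw [one_add_one_eq_two, ENNReal.inv_mul_cancel (by simp) (by simp), one_mul]

theorem fairCoin_preimage_consSeq_le (b : Bool) {B : Set Cantor} (hB : MeasurableSet B) :
    fairCoin (consSeq b ⁻¹' B) ≤ 2 * fairCoin B := by
  have h : 2 * fairCoin B =
      fairCoin (consSeq false ⁻¹' B) + fairCoin (consSeq true ⁻¹' B) := by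
    conv_lhs => rw [fairCoin_eq_map_consSeq]
    rw [Measure.smul_apply, Measure.add_apply, Measure.map_apply (measurable_consSeq _) hB,
      Measure.map_apply (measurable_consSeq _) hB, smul_eq_mul, ← mul_assoc,
      ENNReal.mul_inv_cancel (by simp) (by simp), one_mul]
  rw [h]
  cases b
  · exact le_self_add
  · exact le_add_self

/-- The sequence `σ ⌢ X`. -/
def appendSeq (σ : Str) (X : Cantor) : Cantor := σ.foldr consSeq X

theorem measurable_appendSeq (σ : Str) : Measurable (appendSeq σ) := by
  induction σ with
  | nil => exact measurable_id
  | cons b σ ih => exact (measurable_consSeq b).comp ih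

theorem prefixOf_appendSeq (ρ : Str) {σ : Str} {X : Cantor} (h : PrefixOf σ X) :
    PrefixOf (ρ ++ σ) (appendSeq ρ X) := by
  induction ρ with
  | nil => exact h
  | cons b ρ ih => exact prefixOf_cons.2 ih

/-- Oracles beginning with `σ` form a copy of Cantor space scaled by `2 ^ (-σ.length)`. This is the
price of simulating a functional behind a fixed prefix. -/
theorem fairCoin_preimage_appendSeq_le (σ : Str) {B : Set Cantor} (hB : MeasurableSet B) :
    fairCoin (appendSeq σ ⁻¹' B) ≤ 2 ^ σ.length * fairCoin B := by
  induction σ generalizing B with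
  | nil => rw [List.length_nil, pow_zero, one_mul]; exact le_rfl
  | cons b σ ih =>
    calc fairCoin (appendSeq σ ⁻¹' (consSeq b ⁻¹' B))
        ≤ 2 ^ σ.length * fairCoin (consSeq b ⁻¹' B) := ih (measurable_consSeq b hB)
      _ ≤ 2 ^ σ.length * (2 * fairCoin B) := by
        gcongr; exact fairCoin_preimage_consSeq_le b hB
      _ = 2 ^ (b :: σ).length * fairCoin B := by
        rw [List.length_cons, pow_succ, mul_assoc]

/-- `M` dominates the semi-measure induced by any Turing functional. -/
theorem inducedSemimeasure_le_aprioriM {Φ : Set (Str × Str)} (h : IsTuringFunctional Φ) :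
    ∃ c : ℕ, ∀ τ, inducedSemimeasure Φ τ ≤ 2 ^ c * aprioriM τ := by
  obtain ⟨e, rfl⟩ := exists_functional_eq h
  -- The constant is `e + 1`, the length of the prefix `1^e 0` that selects `Φ_e`.
  refine ⟨(List.replicate e true ++ [false]).length, fun τ => ?_⟩
  refine (measure_mono fun X hX => ?_).trans
    (fairCoin_preimage_appendSeq_le _ (measurableSet_outputs universalFunctional τ))
  rcases hX with h | ⟨σ, τ', hm, hp, ht⟩
  · exact Or.inl h
  · exact Or.inr ⟨_, τ', ⟨e, σ, hm, by simp⟩, prefixOf_appendSeq _ hp, ht⟩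

theorem outputs_comparable {Φ : Set (Str × Str)} (h : Consistent Φ) {X : Cantor} {σ τ : Str}
    (h1 : Outputs Φ X σ) (h2 : Outputs Φ X τ) : Comparable σ τ := by
  rcases h1 with rfl | ⟨ρ, σ', hm, hp, hs⟩
  · exact Or.inl List.nil_prefix
  rcases h2 with rfl | ⟨ρ', τ', hm', hp', ht⟩
  · exact Or.inr List.nil_prefix
  refine (h.comparable hm hm' ?_).of_prefix hs ht
  rw [← show restr X ρ.length = ρ from hp, ← show restr X ρ'.length = ρ' from hp']
  exact (le_total ρ.length ρ'.length).imp (restr_prefix X) (restr_prefix X)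

theorem Comparable.eq_of_length {σ τ : Str} (h : Comparable σ τ) (hl : σ.length = τ.length) :
    σ = τ :=
  h.elim (fun h => h.eq_of_length hl) fun h => (h.eq_of_length hl.symm).symm

/-- The a priori probability of a set of strings of the same length is the probability that the
universal functional extends one of them. -/
theorem tsum_aprioriM {S : Set Str} {m : ℕ} (hS : ∀ σ ∈ S, σ.length = m) :
    ∑' σ : S, aprioriM σ = fairCoin (⋃ σ : S, {X | Outputs universalFunctional X σ}) := by
  refine (measure_iUnion ?_ fun σ => measurableSet_outputs _ _).symm
  intro σ τ hne
  refine Set.disjoint_left.2 fun X h1 h2 => hne (Subtype.ext ?_)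
  exact (outputs_comparable isTuringFunctional_universal.2 h1 h2).eq_of_length
    ((hS _ σ.2).trans (hS _ τ.2).symm)

/-! ### Composition of functionals -/

/-- The composition of two functionals: `Φ` is applied first. -/
def compFunctional (Ψ Φ : Set (Str × Str)) : Set (Str × Str) :=
  {p | ∃ τ' : Str, (τ', p.2) ∈ Ψ ∧ (τ' = [] ∨ ∃ τ : Str, (p.1, τ) ∈ Φ ∧ τ' <+: τ)}

theorem isTuringFunctional_comp {Ψ Φ : Set (Str × Str)} (h1 : IsTuringFunctional Ψ)
    (h2 : IsTuringFunctional Φ) : IsTuringFunctional (compFunctional Ψ Φ) := by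
  obtain ⟨hΨ, cΨ⟩ := h1
  obtain ⟨hΦ, cΦ⟩ := h2
  constructor
  · refine re_exists (p := fun (p : Str × Str) (τ' : Str) =>
      (τ', p.2) ∈ Ψ ∧ (τ' = [] ∨ ∃ τ : Str, (p.1, τ) ∈ Φ ∧ τ' <+: τ)) ?_
    refine re_and (re_comp hΨ (f := fun x : (Str × Str) × Str => (x.2, x.1.2)) ?_) (re_or ?_ ?_)
    · exact Computable.snd.pair (Computable.snd.comp Computable.fst)
    · exact re_of_primrec (Primrec.eq.comp Primrec.snd (Primrec.const []))
    · refine re_exists (p := fun (x : (Str × Str) × Str) (τ : Str) =>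
        (x.1.1, τ) ∈ Φ ∧ x.2 <+: τ) ?_
      refine re_and (re_comp hΦ
        (f := fun y : ((Str × Str) × Str) × Str => (y.1.1.1, y.2)) ?_) (re_of_primrec ?_)
      · exact (Computable.fst.comp (Computable.fst.comp Computable.fst)).pair Computable.snd
      · exact primrec_prefix (Primrec.snd.comp Primrec.fst) Primrec.snd
  · rintro σ υ σ' υ' ⟨τ₁, h1, h1'⟩ ⟨τ₂, h2, h2'⟩ hσ
    refine cΨ.comparable h1 h2 ?_
    rcases h1' with rfl | ⟨τ, hτ, hp⟩
    · exact Or.inl List.nil_prefix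
    rcases h2' with rfl | ⟨τ', hτ', hp'⟩
    · exact Or.inr List.nil_prefix
    exact (cΦ _ _ _ _ hτ hτ' hσ).of_prefix hp hp'

theorem PrefixOf.of_prefix {σ τ : Str} {X : Cantor} (h : PrefixOf τ X) (hp : σ <+: τ) :
    PrefixOf σ X := by
  rw [prefixOf_iff] at h ⊢
  exact fun i hi => (hp.getElem hi).trans (h i (hi.trans_le hp.length_le))

theorem Outputs.of_prefix {Φ : Set (Str × Str)} {X : Cantor} {σ τ : Str} (h : Outputs Φ X τ)
    (hp : σ <+: τ) : Outputs Φ X σ := by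
  rcases h with rfl | ⟨ρ, τ', hm, hX, ht⟩
  · exact Or.inl (List.prefix_nil.1 hp)
  · exact Or.inr ⟨ρ, τ', hm, hX, hp.trans ht⟩

theorem outputs_comp {Ψ Φ : Set (Str × Str)} {X : Cantor} {σ τ : Str} (h : Outputs Φ X σ)
    (hm : (σ, τ) ∈ Ψ) : Outputs (compFunctional Ψ Φ) X τ := by
  rcases h with rfl | ⟨ρ, σ', hΦ, hX, hs⟩
  -- The empty string is output even when `Φ` contains no pair, so axioms of `Ψ` with empty input
  -- need the disjunct `τ' = []` of the composite.
  · exact Or.inr ⟨[], τ, ⟨[], hm, Or.inl rfl⟩, rfl, List.prefix_refl _⟩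
  · exact Or.inr ⟨ρ, τ, ⟨σ, hm, Or.inr ⟨σ', hΦ, hs⟩⟩, hX, List.prefix_refl _⟩

/-- If a Turing functional maps each string of `S` to an extension of a string of `S'`, then the
a priori probability of `S` is, up to a constant factor, at most that of `S'`. -/
theorem exists_tsum_aprioriM_le {Φ : Set (Str × Str)} (hΦ : IsTuringFunctional Φ) :
    ∃ c : ℕ, ∀ (S S' : Set Str) (m : ℕ), (∀ σ ∈ S, σ.length = m) →
      (∀ σ ∈ S, ∃ σ' τ : Str, (σ', τ) ∈ Φ ∧ σ' <+: σ ∧ ∃ τ' ∈ S', τ' <+: τ) →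
      ∑' σ : S, aprioriM σ ≤ 2 ^ c * ∑' τ : S', aprioriM τ := by
  obtain ⟨c, hc⟩ := inducedSemimeasure_le_aprioriM
    (isTuringFunctional_comp hΦ isTuringFunctional_universal)
  refine ⟨c, fun S S' m hS h => ?_⟩
  -- Equal lengths make the events for `S` disjoint, so their sum is the measure of a union. For
  -- `S'` a union bound suffices, hence no condition on its lengths.
  rw [tsum_aprioriM hS, ← ENNReal.tsum_mul_left]
  calc fairCoin (⋃ σ : S, {X | Outputs universalFunctional X σ})
      ≤ fairCoin (⋃ τ : S', {X | Outputs (compFunctional Φ universalFunctional) X τ}) := by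
        refine measure_mono (Set.iUnion_subset fun σ X hX => ?_)
        obtain ⟨σ', τ, hm, hσ, τ', hτ', ht⟩ := h σ σ.2
        exact Set.mem_iUnion.2 ⟨⟨τ', hτ'⟩,
          (outputs_comp (Outputs.of_prefix hX hσ) hm).of_prefix ht⟩
    _ ≤ ∑' τ : S', fairCoin {X | Outputs (compFunctional Φ universalFunctional) X τ} :=
        measure_iUnion_le _
    _ ≤ ∑' τ : S', 2 ^ c * aprioriM τ := ENNReal.tsum_le_tsum fun τ => hc τ

/-! ### Levels of the canonical tree -/

/-- The a priori probability of the `n`-th level of the canonical tree. -/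
noncomputable def levelMass (C : Set Cantor) (n : ℕ) : ℝ≥0∞ :=
  ∑' σ : level (canonicalTree C) n, aprioriM σ

theorem restr_mem_level {C : Set Cantor} {X : Cantor} (hX : X ∈ C) (n : ℕ) :
    restr X n ∈ level (canonicalTree C) n :=
  ⟨⟨X, hX, prefixOf_restr X n⟩, length_restr X n⟩

theorem mem_level {C : Set Cantor} {σ : Str} {n : ℕ} :
    σ ∈ level (canonicalTree C) n ↔ ∃ X ∈ C, restr X n = σ := by
  constructor
  · rintro ⟨⟨X, hX, hp⟩, rfl⟩
    exact ⟨X, hX, hp⟩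
  · rintro ⟨X, hX, rfl⟩
    exact restr_mem_level hX n

/-- An oracle that yields a string of the tree also yields its prefixes, and these stay in the tree.
-/
theorem levelMass_antitone (C : Set Cantor) : Antitone (levelMass C) := by
  intro n m hnm
  unfold levelMass
  rw [tsum_aprioriM (m := m) fun σ hσ => hσ.2, tsum_aprioriM (m := n) fun σ hσ => hσ.2]
  refine measure_mono (Set.iUnion_subset fun ⟨σ, hσ⟩ X hX => ?_)
  obtain ⟨Y, hY, rfl⟩ := mem_level.1 hσ
  exact Set.mem_iUnion.2 ⟨⟨restr Y n, restr_mem_level hY n⟩,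
    Outputs.of_prefix hX (restr_prefix Y hnm)⟩

theorem levelMass_le_one (C : Set Cantor) (n : ℕ) : levelMass C n ≤ 1 := by
  unfold levelMass
  rw [tsum_aprioriM (m := n) fun σ hσ => hσ.2]
  have : IsProbabilityMeasure fairCoin := by unfold fairCoin; infer_instance
  exact prob_le_one

theorem computable_findGreatest_le {f : ℕ → ℕ} (hf : Computable f) :
    Computable fun m => Nat.findGreatest (fun k => f k ≤ m) m := by
  have hle : Computable₂ fun a b : ℕ => decide (a ≤ b) := Primrec.nat_le.decide.to_comp
  have hk : Computable fun x : ℕ × ℕ × ℕ => x.2.1 + 1 :=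
    Computable.succ.comp (Computable.fst.comp Computable.snd)
  have hstep : Computable₂ fun (m : ℕ) (y : ℕ × ℕ) =>
      bif decide (f (y.1 + 1) ≤ m) then y.1 + 1 else y.2 :=
    Computable.cond (hle.comp (hf.comp hk) Computable.fst) hk
      (Computable.snd.comp Computable.snd)
  refine (Computable.nat_rec Computable.id (Computable.const 0) hstep).of_eq fun m => ?_
  suffices ∀ n, (Nat.rec 0 (fun k r => bif decide (f (k + 1) ≤ m) then k + 1 else r) n : ℕ) =
      Nat.findGreatest (fun k => f k ≤ m) n from this m
  intro n
  induction n with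
  | zero => rfl
  | succ n ih =>
    rw [Nat.findGreatest_succ, ← ih]
    by_cases h : f (n + 1) ≤ m <;> simp [h]

/-- A class is deep if and only if one can compute, for each `k`, a level of its canonical tree
whose a priori probability is at most `2 ^ (-k)`. -/
theorem isDeep_iff {C : Set Cantor} :
    IsDeep C ↔ ∃ f : ℕ → ℕ, Computable f ∧ ∀ k, levelMass C (f k) ≤ (2⁻¹ : ℝ≥0∞) ^ k := by
  have hhalf : (2⁻¹ : ℝ≥0∞) ≤ 1 := by simp
  constructor
  · rintro ⟨h, ⟨hc, -, hu⟩, hle⟩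
    obtain ⟨f, hf, hfk⟩ := exists_computable_choice (p := fun k n => k ≤ h n)
      (ComputablePred.to_re ⟨fun x => inferInstanceAs (Decidable (x.1 ≤ h x.2)),
        Primrec.nat_le.decide.to_comp.comp Computable.fst (hc.comp Computable.snd)⟩) hu
    exact ⟨f, hf, fun k => (hle (f k)).trans (pow_le_pow_right_of_le_one' hhalf (hfk k))⟩
  · rintro ⟨f, hf, hle⟩
    -- The order inverts `f`: at `m` it takes the greatest `k ≤ m` whose level `f k` has been
    -- reached, so it is at least `k` from `max k (f k)` on.
    refine ⟨fun m => Nat.findGreatest (fun k => f k ≤ m) m,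
      ⟨computable_findGreatest_le hf, fun m n hmn => ?_, fun k => ⟨max k (f k), ?_⟩⟩, fun m => ?_⟩
    · exact Nat.findGreatest_mono (fun k hk => le_trans hk hmn) hmn
    · exact Nat.le_findGreatest (le_max_left _ _) (le_max_right _ _)
    · change levelMass C m ≤ _
      -- The value `0` may be a default, without `f 0 ≤ m`; then only the trivial bound `1` is
      -- needed.
      rcases Nat.eq_zero_or_pos (Nat.findGreatest (fun k => f k ≤ m) m) with h0 | hpos
      · simpa only [h0, pow_zero] using levelMass_le_one C m
      · have hm : f (Nat.findGreatest (fun k => f k ≤ m) m) ≤ m :=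
          Nat.findGreatest_of_ne_zero (P := fun k => f k ≤ m) rfl hpos.ne'
        exact (levelMass_antitone C hm).trans (hle _)

/-! ### Compactness and the computable use bound -/

theorem restr_getD (σ : Str) : restr (fun i => σ.getD i false) σ.length = σ :=
  prefixOf_iff.2 fun i hi => by simp [hi]

/-- Compactness of Cantor space: the sets where `P` holds of the first `n` bits are open and
increase with `n`, so a single one already covers the space. -/
theorem exists_length_of_forall {P : Str → Prop} (hP : ∀ σ τ, σ <+: τ → P σ → P τ)
    (h : ∀ X, ∃ n, P (restr X n)) : ∃ m, ∀ σ : Str, σ.length = m → P σ := by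
  have hopen (n : ℕ) : IsOpen {X : Cantor | P (restr X n)} := by
    have hcont : Continuous fun (X : Cantor) (i : Fin n) => X i := by fun_prop
    have heq : {X : Cantor | P (restr X n)} =
        (fun (X : Cantor) (i : Fin n) => X i) ⁻¹' {v | P (List.ofFn v)} := by
      ext X
      have : restr X n = List.ofFn fun i : Fin n => X i :=
        List.ext_getElem (by simp [restr]) fun i h1 h2 => by simp [restr]
      simp [this]
    rw [heq]
    exact (isOpen_discrete _).preimage hcont
  obtain ⟨m, hm⟩ := isCompact_univ.elim_directed_cover (fun n => {X : Cantor | P (restr X n)})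
    hopen (fun X _ => Set.mem_iUnion.2 (h X))
    (Monotone.directed_le fun n m hnm X hX => hP _ _ (restr_prefix X hnm) hX)
  refine ⟨m, fun σ hσ => ?_⟩
  have := hm (Set.mem_univ fun i => σ.getD i false)
  rw [← hσ, Set.mem_ofPred_eq, restr_getD] at this
  exact this

/-- If a functional is total on a `Π⁰₁` class, then its use on the class is bounded by a
computable function. -/
theorem exists_computable_use {C D : Set Cantor} (hD : IsPi01 D) {Φ : Set (Str × Str)}
    (hΦ : IsTuringFunctional Φ) (hm : ∀ X ∈ D, ∃ Y ∈ C, MapsTo Φ X Y) :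
    ∃ u : ℕ → ℕ, Computable u ∧ ∀ n, 0 < n → ∀ σ ∈ level (canonicalTree D) (u n),
      ∃ σ' τ : Str, (σ', τ) ∈ Φ ∧ σ' <+: σ ∧ n ≤ τ.length := by
  obtain ⟨S, hS, rfl⟩ := hD
  -- `σ` has been seen to leave `D`, or to produce `n` bits of output. This is c.e. and passes to
  -- extensions, while membership in the tree is only co-c.e. The case `n = 0` is separate because
  -- empty output requires no pair of `Φ`.
  let P : ℕ → Str → Prop := fun n σ => (∃ ρ ∈ S, ρ <+: σ) ∨
    (n = 0 ∨ ∃ p : Str × Str, p ∈ Φ ∧ p.1 <+: σ ∧ n ≤ p.2.length)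
  have hre : REPred fun x : ℕ × Str => P x.1 x.2 := by
    refine re_or (re_exists (p := fun (x : ℕ × Str) (ρ : Str) => ρ ∈ S ∧ ρ <+: x.2) ?_)
      (re_or (re_of_primrec (Primrec.eq.comp Primrec.fst (Primrec.const 0)))
        (re_exists (p := fun (x : ℕ × Str) (p : Str × Str) =>
          p ∈ Φ ∧ p.1 <+: x.2 ∧ x.1 ≤ p.2.length) ?_))
    · exact re_and (re_comp hS Computable.snd)
        (re_of_primrec (primrec_prefix Primrec.snd (Primrec.snd.comp Primrec.fst)))
    · refine re_and (re_comp hΦ.1 Computable.snd) (re_and (re_of_primrec ?_) (re_of_primrec ?_))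
      · exact primrec_prefix (Primrec.fst.comp Primrec.snd) (Primrec.snd.comp Primrec.fst)
      · exact Primrec.nat_le.comp (Primrec.fst.comp Primrec.fst)
          (Primrec.list_length.comp (Primrec.snd.comp Primrec.snd))
  obtain ⟨u, hu, hP⟩ := exists_computable_choice (re_forall_length hre) fun n => by
    refine exists_length_of_forall (P := P n) (fun σ τ hστ => ?_) fun X => ?_
    · rintro (⟨ρ, hρ, hp⟩ | h0 | ⟨p, hp, hσ, hn⟩)
      · exact Or.inl ⟨ρ, hρ, hp.trans hστ⟩
      · exact Or.inr (Or.inl h0)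
      · exact Or.inr (Or.inr ⟨p, hp, hσ.trans hστ, hn⟩)
    · by_cases hX : X ∈ openOf S
      · obtain ⟨ρ, hρ, hp⟩ := hX
        refine ⟨ρ.length, Or.inl ⟨ρ, hρ, ?_⟩⟩
        rw [show restr X ρ.length = ρ from hp]
      · obtain ⟨Y, -, hY⟩ := hm X hX
        rcases hY n with h | ⟨σ, τ, hσ, hp, ht⟩
        · exact ⟨0, Or.inr (Or.inl (by simpa [length_restr] using congrArg List.length h))⟩
        · refine ⟨σ.length, Or.inr (Or.inr ⟨(σ, τ), hσ, ?_, ?_⟩)⟩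
          · rw [show restr X σ.length = σ from hp]
          · simpa [length_restr] using ht.length_le
  refine ⟨u, hu, fun n hn0 σ hσ => ?_⟩
  rcases hP n σ hσ.2 with ⟨ρ, hρ, hp⟩ | h0 | ⟨p, hp, hpσ, hn⟩
  -- A string of the canonical tree has an extension in `D`, so it has no prefix in `S`.
  · obtain ⟨⟨X, hX, hXσ⟩, -⟩ := hσ
    exact absurd ⟨ρ, hρ, hXσ.of_prefix hp⟩ hX
  · exact absurd h0 hn0.ne'
  · exact ⟨p.1, p.2, hp, hpσ, hn⟩

/-! ### The filter of deep degrees -/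

theorem two_pow_mul_inv_pow_add (c k : ℕ) :
    (2 : ℝ≥0∞) ^ c * (2⁻¹ : ℝ≥0∞) ^ (c + k) = (2⁻¹ : ℝ≥0∞) ^ k := by
  rw [pow_add, ← mul_assoc, ← mul_pow, ENNReal.mul_inv_cancel (by simp) (by simp), one_pow, one_mul]

theorem IsDeep.of_medvedevLE {C D : Set Cantor} (hC : IsDeep C) (hD : IsPi01 D)
    (h : MedvedevLE C D) : IsDeep D := by
  obtain ⟨Φ, hΦ, hm⟩ := h
  obtain ⟨u, hu, hus⟩ := exists_computable_use hD hΦ hm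
  obtain ⟨c, hc⟩ := exists_tsum_aprioriM_le hΦ
  obtain ⟨f, hf, hfk⟩ := isDeep_iff.1 hC
  -- The shift by `c` absorbs the factor `2 ^ c`; the `+ 1` makes the output length positive, as the
  -- use bound requires.
  refine isDeep_iff.2 ⟨fun k => u (f (c + k) + 1), hu.comp (Computable.succ.comp (hf.comp
    (Primrec.nat_add.to_comp.comp (Computable.const c) Computable.id))), fun k => ?_⟩
  set n := f (c + k) + 1 with hn
  calc levelMass D (u n) ≤ 2 ^ c * levelMass C n := by
        refine hc _ _ (u n) (fun σ hσ => hσ.2) fun σ hσ => ?_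
        obtain ⟨σ', τ, hΦm, hp, hl⟩ := hus n (Nat.succ_pos _) σ hσ
        obtain ⟨X, hX, rfl⟩ := mem_level.1 hσ
        obtain ⟨Y, hY, hXY⟩ := hm X hX
        refine ⟨σ', τ, hΦm, hp, restr Y n, restr_mem_level hY n, ?_⟩
        have hτ : Outputs Φ X τ :=
          Or.inr ⟨σ', τ, hΦm, (prefixOf_restr X _).of_prefix hp, List.prefix_refl _⟩
        -- Both strings are outputs on `X`, hence comparable, and `τ` has length at least `n`; so
        -- `τ` extends `restr Y n`.
        rcases outputs_comparable hΦ.2 (hXY n) hτ with h | h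
        · exact h
        · rw [h.eq_of_length_le (by rwa [length_restr])]
    _ ≤ 2 ^ c * (2⁻¹ : ℝ≥0∞) ^ (c + k) := by
        gcongr
        exact (levelMass_antitone C (Nat.le_succ _)).trans (hfk _)
    _ = (2⁻¹ : ℝ≥0∞) ^ k := two_pow_mul_inv_pow_add c k

/-- The functional which removes the first bit. -/
theorem isTuringFunctional_tail : IsTuringFunctional {p | p.2 = p.1.tail} := by
  refine ⟨re_of_primrec (Primrec.eq.comp Primrec.snd (Primrec.list_tail.comp Primrec.fst)), ?_⟩
  intro σ τ σ' τ' h1 h2 h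
  simp only [Set.mem_ofPred_eq] at h1 h2
  subst h1 h2
  rcases σ with _ | ⟨b, σ⟩
  · exact Or.inl List.nil_prefix
  · rcases σ' with _ | ⟨b', σ'⟩
    · simp at h
    · exact Or.inl (List.cons_prefix_cons.1 h).2

theorem IsDeep.infClass {C D : Set Cantor} (hC : IsDeep C) (hD : IsDeep D) :
    IsDeep (infClass C D) := by
  obtain ⟨c, hc⟩ := exists_tsum_aprioriM_le isTuringFunctional_tail
  obtain ⟨f, hf, hfk⟩ := isDeep_iff.1 hC
  obtain ⟨g, hg, hgk⟩ := isDeep_iff.1 hD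
  have hadd : Computable fun k : ℕ => c + (k + 1) :=
    Primrec.nat_add.to_comp.comp (Computable.const c) Computable.succ
  -- In the exponent, `c` cancels the domination constant and the extra `1` pays for adding two
  -- masses; the outer `+ 1` accounts for the deleted first bit.
  refine isDeep_iff.2 ⟨fun k => max (f (c + (k + 1))) (g (c + (k + 1))) + 1,
    Computable.succ.comp (Primrec.nat_max.to_comp.comp (hf.comp hadd) (hg.comp hadd)),
    fun k => ?_⟩
  set n := max (f (c + (k + 1))) (g (c + (k + 1))) with hn
  calc levelMass (DeepClasses.infClass C D) (n + 1)
      ≤ 2 ^ c * ∑' τ : (level (canonicalTree C) n ∪ level (canonicalTree D) n : Set Str),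
          aprioriM τ := by
        refine hc _ _ (n + 1) (fun σ hσ => hσ.2) fun σ hσ => ?_
        obtain ⟨X, hX, rfl⟩ := mem_level.1 hσ
        rcases hX with ⟨Y, hY, rfl⟩ | ⟨Y, hY, rfl⟩ <;> rw [restr_consSeq]
        · exact ⟨false :: restr Y n, restr Y n, rfl, List.prefix_refl _, restr Y n,
            Or.inl (restr_mem_level hY n), List.prefix_refl _⟩
        · exact ⟨true :: restr Y n, restr Y n, rfl, List.prefix_refl _, restr Y n,
            Or.inr (restr_mem_level hY n), List.prefix_refl _⟩
    _ ≤ 2 ^ c * (levelMass C n + levelMass D n) := by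
        gcongr
        exact ENNReal.tsum_union_le aprioriM _ _
    _ ≤ 2 ^ c * ((2⁻¹ : ℝ≥0∞) ^ (c + (k + 1)) + (2⁻¹ : ℝ≥0∞) ^ (c + (k + 1))) := by
        gcongr
        · exact (levelMass_antitone C (le_max_left _ _)).trans (hfk _)
        · exact (levelMass_antitone D (le_max_right _ _)).trans (hgk _)
    _ = (2⁻¹ : ℝ≥0∞) ^ k := by
        rw [mul_add, two_pow_mul_inv_pow_add, pow_succ, ← mul_add, ENNReal.inv_two_add_inv_two,
          mul_one]

end DeepClasses

theorem mainTheorem4 :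
    (∀ C D : DeepClasses.Pi01Class, C ≤ D →
      DeepClasses.IsDeep C.carrier → DeepClasses.IsDeep D.carrier) ∧
    (∀ C D : DeepClasses.Pi01Class, DeepClasses.IsDeep C.carrier → DeepClasses.IsDeep D.carrier →
      DeepClasses.IsDeep (DeepClasses.infClass C.carrier D.carrier)) ∧
    DeepClasses.IsLatticeFilter DeepClasses.deepDegrees := by
  refine ⟨fun C D h hC => hC.of_medvedevLE D.isPi01 h, fun C D hC hD => hC.infClass hD, ?_, ?_⟩
  · rintro _ y ⟨C, hC, rfl⟩ h
    obtain ⟨D, rfl⟩ : ∃ D, DeepClasses.degree D = y := Quotient.exists_rep y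
    -- The order of two degrees unfolds to Medvedev reducibility of their representatives, so `h`
    -- applies as it stands.
    exact ⟨D, hC.of_medvedevLE D.isPi01 h, rfl⟩
  · rintro _ _ ⟨C, hC, rfl⟩ ⟨D, hD, rfl⟩
    exact ⟨C.inf D, hC.infClass hD, rfl⟩
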